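/- **Theorem 1.3 (Bilinear Strichartz estimate).** For $\lambda\ge 1$ let $\mathbb{T}_\lambda=\mathbb{R}/(\lambda\mathbb{Z})$, and let $\square=\partial_{x_1}^2-\partial_{x_2}^2$ on $\mathbb{R}\times\mathbb{T}_\lambda$, so that $e^{it\square}$ is the unitary group on $L^2(\mathbb{R}\times\mathbb{T}_\lambda)$ given by the Fourier multiplier $e^{-4\pi^2 it(\xi_1^2-\xi_2^2)}$, $\xi\in\mathbb{R}\times\frac1\lambda\mathbb{Z}$. Fix Littlewood–Paley cutoffs: bounded measurable functions $\chi,\psi:\mathbb{R}^2\to\mathbb{C}$ with $\chi(\xi)=0$ unless $|\xi|\le R$ and $\psi(\xi)=0$ unless $r\le|\xi|\le R$, where $r>0$. For integers $N\ge1$ let $P_N$ be the Fourier multiplier on $L^2(\mathbb{R}\times\mathbb{T}_\lambda)$ with symbol $\psi(\xi/N)$ if $N\ge2$ and $\chi(\xi)$ if $N=1$ (the choice $\chi=\psi$ is allowed). There are constants $K$ and $C$, depending only on the cutoffs, such that for all real $\lambda\ge1$, all integers $N_2\ge1$ and $N_1\ge K N_2$, and all $\phi_1,\phi_2\in L^2(\mathbb{R}\times\mathbb{T}_\lambda)$,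 $$\big\|e^{it\square}P_{N_1}\phi_1\cdot e^{it\square}P_{N_2}\phi_2\big\|_{L^2_{t,x}([0,1]\times\mathbb{R}\times\mathbb{T}_\lambda)}\le C\Big(\frac1\lambda+\frac{N_2}{N_1}\Big)^{1/2}\|\phi_1\|_{L^2}\|\phi_2\|_{L^2}.$$ -/

import Mathlib

open MeasureTheory
open scoped FourierTransform ENNReal

noncomputable section

/-- The space `L²(ℝ × 𝕋_L)`, where `𝕋_L = ℝ / Lℤ` carries the measure induced by Lebesgue measure
(of total mass `L`) and `ℝ × 𝕋_L` carries the product measure. -/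
abbrev L2Cyl (L : ℝ) [Fact (0 < L)] : Type :=
  Lp ℂ 2 (volume : Measure (ℝ × AddCircle L))

/-- A bounded measurable function on the frequency plane `ℝ²`. -/
structure FourierSymbol where
  toFun : ℝ → ℝ → ℂ
  measurable : Measurable (fun ξ : ℝ × ℝ => toFun ξ.1 ξ.2)
  bounded : ∃ B : ℝ, ∀ ξ₁ ξ₂ : ℝ, ‖toFun ξ₁ ξ₂‖ ≤ B

theorem memLp_mode (L : ℝ) [Fact (0 < L)] (k : ℤ) (f : Lp ℂ 2 (volume : Measure ℝ)) :
    MemLp (fun x : ℝ × AddCircle L => fourier k x.2 * f x.1) 2 volume := by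
  have h1 : MemLp (fun x : ℝ × AddCircle L => f x.1) 2 volume :=
    (Lp.memLp f).comp_fst (volume : Measure (AddCircle L))
  refine h1.of_le (((fourier k).continuous.measurable.comp measurable_snd).aestronglyMeasurable.mul
    h1.1) (Filter.Eventually.of_forall fun x => ?_)
  rw [norm_mul, fourier_apply, Circle.norm_coe, one_mul]

/-- The function `(x₁, x₂) ↦ e^{2πi k x₂ / L} f(x₁)` of `L²(ℝ × 𝕋_L)`. -/
def mode (L : ℝ) [Fact (0 < L)] (k : ℤ) (f : Lp ℂ 2 (volume : Measure ℝ)) : L2Cyl L :=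
  (memLp_mode L k f).toLp _

theorem memLp_circleCoeff (L : ℝ) [Fact (0 < L)] (k : ℤ) (φ : L2Cyl L) :
    MemLp (fun x₁ : ℝ => (1 / L : ℂ) * ∫ x₂ : AddCircle L, fourier (-k) x₂ * φ (x₁, x₂))
      2 volume := by
  refine MemLp.const_mul ?_ _
  have hm : AEStronglyMeasurable
      (fun x : ℝ × AddCircle L => fourier (-k) x.2 * φ x)
      ((volume : Measure ℝ).prod (volume : Measure (AddCircle L))) :=
    ((fourier (-k)).continuous.measurable.comp measurable_snd).aestronglyMeasurable.mul
      (Lp.aestronglyMeasurable φ)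
  refine ⟨hm.integral_prod_right', ?_⟩
  rw [eLpNorm_lt_top_iff_lintegral_rpow_enorm_lt_top (by norm_num) (by norm_num)]
  have hφ := (eLpNorm_lt_top_iff_lintegral_rpow_enorm_lt_top (by norm_num) (by norm_num)).1
    (Lp.memLp φ).2
  have hφm : AEMeasurable (fun x : ℝ × AddCircle L => ‖φ x‖ₑ ^ (2 : ℝ))
      ((volume : Measure ℝ).prod (volume : Measure (AddCircle L))) :=
    (Lp.aestronglyMeasurable φ).enorm.pow_const _
  simp only [ENNReal.toReal_ofNat] at hφ ⊢
  replace hφ : ∫⁻ x₁ : ℝ, ∫⁻ x₂ : AddCircle L, ‖φ (x₁, x₂)‖ₑ ^ (2 : ℝ) < ∞ :=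
    (lintegral_prod _ hφm).symm.trans_lt hφ
  have key : ∀ᵐ x₁ : ℝ, ‖∫ x₂ : AddCircle L, fourier (-k) x₂ * φ (x₁, x₂)‖ₑ ^ (2 : ℝ) ≤
      ENNReal.ofReal L * ∫⁻ x₂ : AddCircle L, ‖φ (x₁, x₂)‖ₑ ^ (2 : ℝ) := by
    have hs := (Lp.aestronglyMeasurable φ).prodMk_left
    filter_upwards [hs] with x₁ hx
    have h1 : ‖∫ x₂ : AddCircle L, fourier (-k) x₂ * φ (x₁, x₂)‖ₑ ≤
        ∫⁻ x₂ : AddCircle L, ‖φ (x₁, x₂)‖ₑ := by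
      refine (enorm_integral_le_lintegral_enorm _).trans (le_of_eq ?_)
      congr 1
      ext x₂
      rw [← ofReal_norm, norm_mul, fourier_apply, Circle.norm_coe, one_mul, ofReal_norm]
    have h2 := ENNReal.lintegral_mul_le_Lp_mul_Lq (volume : Measure (AddCircle L))
      Real.HolderConjugate.two_two hx.enorm (aemeasurable_const (b := (1 : ℝ≥0∞)))
    simp only [Pi.mul_apply, mul_one, ENNReal.one_rpow, lintegral_one,
      AddCircle.measure_univ] at h2
    calc _ ≤ (_ : ℝ≥0∞) ^ (2 : ℝ) := ENNReal.rpow_le_rpow (h1.trans h2) (by norm_num)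
      _ = _ := by
        rw [ENNReal.mul_rpow_of_nonneg _ _ (by norm_num), ← ENNReal.rpow_mul,
          ← ENNReal.rpow_mul, mul_comm]
        norm_num
  refine (lintegral_mono_ae key).trans_lt ?_
  rw [lintegral_const_mul' _ _ ENNReal.ofReal_ne_top]
  exact ENNReal.mul_lt_top ENNReal.ofReal_lt_top hφ

/-- The `k`-th Fourier coefficient in the periodic variable,
`φ_k(x₁) = (1/L) ∫_{𝕋_L} e^{-2πi k x₂ / L} φ(x₁, x₂) dx₂`, an element of `L²(ℝ)`. -/
def circleCoeff (L : ℝ) [Fact (0 < L)] (k : ℤ) (φ : L2Cyl L) : Lp ℂ 2 (volume : Measure ℝ) :=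
  (memLp_circleCoeff L k φ).toLp _

theorem memLp_symbolMul (m : FourierSymbol) (ξ₂ : ℝ) (g : Lp ℂ 2 (volume : Measure ℝ)) :
    MemLp (fun ξ₁ : ℝ => m.toFun ξ₁ ξ₂ * g ξ₁) 2 volume := by
  obtain ⟨B, hB⟩ := m.bounded
  refine (Lp.memLp g).of_le_mul (c := B) (AEStronglyMeasurable.mul ?_ (Lp.aestronglyMeasurable g))
    (Filter.Eventually.of_forall fun x => ?_)
  · exact (m.measurable.comp (measurable_id.prodMk measurable_const)).aestronglyMeasurable
  · rw [norm_mul]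
    exact mul_le_mul_of_nonneg_right (hB _ _) (norm_nonneg _)

/-- Multiplication of `g ∈ L²(ℝ)` by `ξ₁ ↦ m(ξ₁, ξ₂)`, for a fixed `ξ₂`. -/
def symbolMul (m : FourierSymbol) (ξ₂ : ℝ) (g : Lp ℂ 2 (volume : Measure ℝ)) :
    Lp ℂ 2 (volume : Measure ℝ) :=
  (memLp_symbolMul m ξ₂ g).toLp _

/-- The Fourier multiplier operator on `L²(ℝ × 𝕋_L)` with symbol `m`, that is, the operator whose
effect on the Fourier side is `φ̂(ξ) ↦ m(ξ) φ̂(ξ)`, `ξ ∈ ℝ × (1/L)ℤ`.  Here `𝓕` is the Fourier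
transform of `L²(ℝ)` with kernel `e^{-2πi x₁ ξ₁}`.  The sum over the frequencies `ξ₂ = k / L` is
a sum in `L²(ℝ × 𝕋_L)` of orthogonal functions with summable squared norms. -/
def fourierMultiplier (L : ℝ) [Fact (0 < L)] (m : FourierSymbol) (φ : L2Cyl L) : L2Cyl L :=
  ∑' k : ℤ, mode L k (𝓕⁻ (symbolMul m (k / L) (𝓕 (circleCoeff L k φ))))

/-- The symbol `e^{-4π² i t (ξ₁² - ξ₂²)}` of `e^{it□}`, `□ = ∂₁² - ∂₂²`. -/
def hyperbolicSymbol (t : ℝ) : FourierSymbol where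
  toFun ξ₁ ξ₂ := Complex.exp ((-(4 * Real.pi ^ 2 * t * (ξ₁ ^ 2 - ξ₂ ^ 2)) : ℝ) * Complex.I)
  measurable := by fun_prop
  bounded := ⟨1, fun ξ₁ ξ₂ => (Complex.norm_exp_ofReal_mul_I _).le⟩

/-- The unitary group `e^{it□}` on `L²(ℝ × 𝕋_L)`: `u(t) = e^{it□} φ` solves
`i ∂_t u + □ u = 0`, `u(0) = φ`. -/
def hyperbolicFlow (L : ℝ) [Fact (0 < L)] (t : ℝ) (φ : L2Cyl L) : L2Cyl L :=
  fourierMultiplier L (hyperbolicSymbol t) φ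

/-- The cutoff functions from which Littlewood-Paley projections are made: `shell` is supported in
an annulus `r ≤ |ξ| ≤ R` and is rescaled to the frequencies `|ξ| ∼ N` for `N ≥ 2`; `low` is
supported in the ball `|ξ| ≤ R` and is used for `N = 1`.  The inhomogeneous convention
(`P_1` keeps all low frequencies) and the homogeneous one (`low = shell`), smooth cutoffs and
sharp ones are all of this form. -/
structure LittlewoodPaleyCutoff where
  low : FourierSymbol
  shell : FourierSymbol
  r : ℝ
  R : ℝ
  r_pos : 0 < r
  low_support : ∀ ξ₁ ξ₂ : ℝ, low.toFun ξ₁ ξ₂ ≠ 0 → Real.sqrt (ξ₁ ^ 2 + ξ₂ ^ 2) ≤ R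
  shell_support : ∀ ξ₁ ξ₂ : ℝ, shell.toFun ξ₁ ξ₂ ≠ 0 →
    r ≤ Real.sqrt (ξ₁ ^ 2 + ξ₂ ^ 2) ∧ Real.sqrt (ξ₁ ^ 2 + ξ₂ ^ 2) ≤ R

/-- The symbol `ξ ↦ m(ξ / N)`. -/
def FourierSymbol.dilate (m : FourierSymbol) (N : ℕ) : FourierSymbol where
  toFun ξ₁ ξ₂ := m.toFun (ξ₁ / N) (ξ₂ / N)
  measurable := m.measurable.comp (f := fun ξ : ℝ × ℝ => (ξ.1 / (N : ℝ), ξ.2 / (N : ℝ)))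
    (by fun_prop)
  bounded := m.bounded.imp fun _ h ξ₁ ξ₂ => h (ξ₁ / N) (ξ₂ / N)

/-- The Littlewood-Paley projection `P_N` on `L²(ℝ × 𝕋_L)`. -/
def lpProj (ψ : LittlewoodPaleyCutoff) (L : ℝ) [Fact (0 < L)] (N : ℕ) (φ : L2Cyl L) : L2Cyl L :=
  fourierMultiplier L (if N = 1 then ψ.low else ψ.shell.dilate N) φ

/-- The norm of `L²_{t,x}([0,1] × ℝ × 𝕋_L)`, as the `L²` norm in `t ∈ [0,1]` of the `L²` norm in
`x`.  It depends only on the class of `F t` modulo null sets for each `t`. -/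
def spaceTimeL2Norm (L : ℝ) [Fact (0 < L)] (F : ℝ → ℝ × AddCircle L → ℂ) : ℝ≥0∞ :=
  (∫⁻ t in Set.Icc (0 : ℝ) 1, eLpNorm (F t) 2 volume ^ 2) ^ (1 / 2 : ℝ)

end

open scoped NNReal Convolution

/-
Plancherel turns the square of the left-hand side into an integral over `t ∈ [0, 1]` of the squared
`L²` norm, on the dual group `ℤ × ℝ`, of the convolution of two functions that evolve by the phase
`φ(y) = -2π (ξ₁² - ξ₂²)`.  At a fixed output frequency `x` this is an oscillatory integral in `t`
with phase `φ(y) + φ(x - y)`, and large sieve reasoning (a window equal to at least a constant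
on `[0, 1]` whose Fourier transform has compact support, then Cauchy-Schwarz on each level set)
bounds it by the largest measure of a set of `y` on which `|y| ≲ N₂`, `|x - y| ≳ N₁` and
`φ(y) + φ(x - y)` stays in a window of bounded length.  This sum of phases is a hyperbolic
quadratic form in `y` centred at `x / 2`, and one coordinate of `y` is at distance `≳ N₁` from that
of the centre.  If it is the continuous one, each of the `≲ 1 + N₂ λ` lattice slices has measure
`≲ 1 / N₁`; if it is the lattice one, the values of the form at consecutive lattice points are
`≳ N₁ / λ` apart, and the measures of the slices sum to `≲ 1 + N₂ λ / N₁`.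
-/

theorem eLpNorm_two_sq {α E : Type*} [MeasurableSpace α] [NormedAddCommGroup E] (μ : Measure α)
    (f : α → E) : eLpNorm f 2 μ ^ 2 = ∫⁻ x, ‖f x‖ₑ ^ 2 ∂μ := by
  have h := eLpNorm_nnreal_pow_eq_lintegral (f := f) (μ := μ) (p := 2) (by norm_num)
  simpa only [ENNReal.coe_ofNat, NNReal.coe_ofNat, ENNReal.rpow_ofNat] using h

theorem enorm_integral_sq_le {α E : Type*} [MeasurableSpace α] [NormedAddCommGroup E]
    [NormedSpace ℝ E] {μ : Measure α} {f : α → E} (hf : AEStronglyMeasurable f μ) :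
    ‖∫ x, f x ∂μ‖ₑ ^ 2 ≤ μ (Function.support f) * ∫⁻ x, ‖f x‖ₑ ^ 2 ∂μ := by
  set T := toMeasurable μ (Function.support f)
  have hT : MeasurableSet T := measurableSet_toMeasurable _ _
  have hfT : ∀ x, T.indicator 1 x * ‖f x‖ₑ = ‖f x‖ₑ := fun x => by
    by_cases hx : x ∈ T
    · rw [Set.indicator_of_mem hx, Pi.one_apply, one_mul]
    · have h0 : f x = 0 := by_contra fun h => hx (subset_toMeasurable _ _ h)
      rw [h0, enorm_zero, mul_zero]
  have hHolder : ∫⁻ x, ‖f x‖ₑ ∂μ ≤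
      (∫⁻ x, T.indicator 1 x ^ (2 : ℝ) ∂μ) ^ (1 / 2 : ℝ) *
        (∫⁻ x, ‖f x‖ₑ ^ (2 : ℝ) ∂μ) ^ (1 / 2 : ℝ) := by
    simpa only [Pi.mul_apply, hfT] using ENNReal.lintegral_mul_le_Lp_mul_Lq μ
      Real.HolderConjugate.two_two (measurable_one.indicator hT).aemeasurable hf.enorm
  have hone : ∫⁻ x, T.indicator 1 x ^ (2 : ℝ) ∂μ = μ (Function.support f) := by
    rw [← measure_toMeasurable, ← lintegral_indicator_one hT]
    refine lintegral_congr fun x => ?_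
    by_cases hx : x ∈ T <;> simp [hx]
  rw [hone, ← ENNReal.mul_rpow_of_nonneg _ _ (by norm_num)] at hHolder
  calc ‖∫ x, f x ∂μ‖ₑ ^ 2 ≤ (∫⁻ x, ‖f x‖ₑ ∂μ) ^ 2 := by
        gcongr
        exact enorm_integral_le_lintegral_enorm f
    _ ≤ ((μ (Function.support f) * ∫⁻ x, ‖f x‖ₑ ^ (2 : ℝ) ∂μ) ^ (1 / 2 : ℝ)) ^ 2 := by gcongr
    _ = μ (Function.support f) * ∫⁻ x, ‖f x‖ₑ ^ 2 ∂μ := by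
        simp only [ENNReal.rpow_ofNat]
        rw [← ENNReal.rpow_mul_natCast]
        norm_num

section RealFourier

theorem continuous_fourierInv {f : ℝ → ℂ} (hf : Integrable f) : Continuous (𝓕⁻ f) := by
  rw [show 𝓕⁻ f = fun x => 𝓕 f (-x) from funext (Real.fourierInv_eq_fourier_neg f)]
  exact (VectorFourier.fourierIntegral_continuous Real.continuous_fourierChar
    (by fun_prop) hf).comp continuous_neg

theorem integral_fourierInv_mul_eq {f g : ℝ → ℂ} (hf : Integrable f) (hg : Integrable g) :
    ∫ x, 𝓕⁻ f x * g x = ∫ x, f x * 𝓕⁻ g x := by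
  have hself : ∀ u : ℝ → ℂ,
      VectorFourier.fourierIntegral Real.fourierChar volume (-innerₗ ℝ) u = 𝓕⁻ u := fun u => by
    ext x
    simp [VectorFourier.fourierIntegral, Real.fourierInv_eq]
  have hflip : ∀ u : ℝ → ℂ,
      VectorFourier.fourierIntegral Real.fourierChar volume (-innerₗ ℝ).flip u = 𝓕⁻ u := fun u => by
    ext x
    simp [VectorFourier.fourierIntegral, Real.fourierInv_eq, mul_comm]
  simpa only [hself, hflip, smul_eq_mul] using
    VectorFourier.integral_fourierIntegral_smul_eq_flip (L := -innerₗ ℝ) (μ := volume)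
      (ν := volume) Real.continuous_fourierChar continuous_inner.neg hf hg

-- Both sides define the same tempered distribution.
theorem fourierInv_Lp_ae_eq {f : Lp ℂ 2 (volume : Measure ℝ)} {g : ℝ → ℂ} (hg : Integrable g)
    (hfg : f =ᵐ[volume] g) :
    (𝓕⁻ f : Lp ℂ 2 (volume : Measure ℝ)) =ᵐ[volume] 𝓕⁻ g := by
  refine ae_eq_of_integral_contDiff_smul_eq ((Lp.memLp _).locallyIntegrable (by norm_num))
    (continuous_fourierInv hg).locallyIntegrable fun φ hφ hφc => ?_
  let ψ : SchwartzMap ℝ ℂ := HasCompactSupport.toSchwartzMap (f := fun x => (φ x : ℂ))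
    (hφc.comp_left (g := fun r : ℝ => (r : ℂ)) (by simp)) (Complex.ofRealCLM.contDiff.comp hφ)
  have hdual : ∫ x, (𝓕⁻ ψ) x • f x = ∫ x, ψ x • (𝓕⁻ f : Lp ℂ 2 (volume : Measure ℝ)) x := by
    simpa only [TemperedDistribution.fourierInv_apply, Lp.toTemperedDistribution_apply] using
      congrArg (fun T => T ψ) (Lp.fourierInv_toTemperedDistribution_eq f)
  have hsmul : ∀ x (z : ℂ), φ x • z = ψ x • z := fun x z => Complex.real_smul
  simp only [hsmul]
  rw [← hdual, integral_congr_ae (hfg.mono fun x hx => congrArg ((𝓕⁻ ψ) x • ·) hx)]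
  simp only [SchwartzMap.fourierInv_coe, smul_eq_mul]
  exact integral_fourierInv_mul_eq ψ.integrable hg

theorem eLpNorm_fourierInv_le {h : ℝ → ℂ} (hh : Integrable h) :
    eLpNorm (𝓕⁻ h) 2 volume ≤ eLpNorm h 2 volume := by
  by_cases hm : MemLp h 2 volume
  · have hnorm := Lp.norm_fourier_eq (𝓕⁻ (hm.toLp h))
    rw [FourierTransform.fourier_fourierInv_eq] at hnorm
    rw [← eLpNorm_congr_ae (fourierInv_Lp_ae_eq hh hm.coeFn_toLp),
      ← eLpNorm_congr_ae hm.coeFn_toLp, ← Lp.enorm_def, ← Lp.enorm_def, ← ofReal_norm,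
      ← ofReal_norm, hnorm]
  · rw [not_imp_comm.1 (fun hne => ⟨hh.1, lt_top_iff_ne_top.2 hne⟩) hm]
    exact le_top

theorem lintegral_sq_fourierInv_le {h : ℝ → ℂ} (hh : Integrable h) :
    ∫⁻ x, ‖𝓕⁻ h x‖ₑ ^ 2 ≤ ∫⁻ x, ‖h x‖ₑ ^ 2 := by
  rw [← eLpNorm_two_sq, ← eLpNorm_two_sq]
  exact pow_le_pow_left₀ zero_le (eLpNorm_fourierInv_le hh) 2

end RealFourier

section Window

variable {α : Type*} [MeasurableSpace α] {μ : Measure α} {φ : α → ℝ} {δ : ℝ} {G : α → ℂ}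

/-- The integral of `G` over the part of the level sets of `φ` at height within `δ` of `τ`.  As a
function of `τ` it is the push-forward of `G dμ` under `φ`, convolved with the indicator function
of `[-δ, δ]`. -/
noncomputable def windowIntegral (μ : Measure α) (φ : α → ℝ) (δ : ℝ) (G : α → ℂ) (τ : ℝ) : ℂ :=
  ∫ y in {y | |φ y - τ| ≤ δ}, G y ∂μ

theorem measurableSet_window (hφ : Measurable φ) (δ : ℝ) :
    MeasurableSet {p : α × ℝ | |φ p.1 - p.2| ≤ δ} :=
  measurableSet_le ((hφ.comp measurable_fst).sub measurable_snd).abs measurable_const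

theorem windowIntegral_eq_integral_indicator (hφ : Measurable φ) (τ : ℝ) :
    windowIntegral μ φ δ G τ =
      ∫ y, {p : α × ℝ | |φ p.1 - p.2| ≤ δ}.indicator (fun p => G p.1) (y, τ) ∂μ :=
  (integral_indicator (measurable_prodMk_right (measurableSet_window hφ δ))).symm

theorem setOf_abs_sub_le (u : ℝ) : {τ : ℝ | |u - τ| ≤ δ} = Set.Icc (u - δ) (u + δ) := by
  ext τ
  rw [Set.mem_ofPred_eq, Set.mem_Icc, abs_le]
  constructor <;> rintro ⟨h₁, h₂⟩ <;> constructor <;> linarith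

theorem lintegral_lintegral_window [SFinite μ] (hφ : Measurable φ) (δ : ℝ) {H : α → ℝ≥0∞}
    (hH : AEMeasurable H μ) :
    ∫⁻ τ, ∫⁻ y in {y | |φ y - τ| ≤ δ}, H y ∂μ = ENNReal.ofReal (2 * δ) * ∫⁻ y, H y ∂μ := by
  have hS := measurableSet_window hφ δ
  calc ∫⁻ τ, ∫⁻ y in {y | |φ y - τ| ≤ δ}, H y ∂μ
      = ∫⁻ τ, ∫⁻ y, {p : α × ℝ | |φ p.1 - p.2| ≤ δ}.indicator (fun p => H p.1) (y, τ) ∂μ :=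
        lintegral_congr fun τ => (lintegral_indicator (measurable_prodMk_right hS) H).symm
    _ = ∫⁻ y, ∫⁻ τ, {p : α × ℝ | |φ p.1 - p.2| ≤ δ}.indicator (fun p => H p.1) (y, τ)
          ∂volume ∂μ :=
        (lintegral_lintegral_swap (f := fun y τ => {p : α × ℝ | |φ p.1 - p.2| ≤ δ}.indicator
          (fun p => H p.1) (y, τ)) (hH.comp_fst.indicator hS)).symm
    _ = ∫⁻ y, ENNReal.ofReal (2 * δ) * H y ∂μ := lintegral_congr fun y => by
        calc _ = ∫⁻ τ, {τ : ℝ | |φ y - τ| ≤ δ}.indicator (fun _ => H y) τ := rfl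
          _ = _ := by
            rw [setOf_abs_sub_le, lintegral_indicator_const measurableSet_Icc, Real.volume_Icc,
              mul_comm]
            congr 2
            ring
    _ = _ := lintegral_const_mul' _ _ ENNReal.ofReal_ne_top

theorem integrable_indicator_window [SFinite μ] (hφ : Measurable φ) (δ : ℝ) (hG : Integrable G μ) :
    Integrable ({p : α × ℝ | |φ p.1 - p.2| ≤ δ}.indicator fun p => G p.1) (μ.prod volume) := by
  have hS := measurableSet_window hφ δ
  have hmeas := (hG.aestronglyMeasurable.comp_fst (ν := (volume : Measure ℝ))).indicator hS
  refine ⟨hmeas, ?_⟩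
  rw [HasFiniteIntegral, lintegral_prod_symm _ hmeas.enorm]
  calc _ = ∫⁻ τ, ∫⁻ y in {y | |φ y - τ| ≤ δ}, ‖G y‖ₑ ∂μ := by
        refine lintegral_congr fun τ => ?_
        have hW : MeasurableSet {y | |φ y - τ| ≤ δ} := measurable_prodMk_right hS
        rw [← lintegral_indicator hW]
        simp only [enorm_indicator_eq_indicator_enorm]
        rfl
    _ = ENNReal.ofReal (2 * δ) * ∫⁻ y, ‖G y‖ₑ ∂μ :=
        lintegral_lintegral_window hφ δ hG.aestronglyMeasurable.enorm
    _ < ∞ := ENNReal.mul_lt_top ENNReal.ofReal_lt_top hG.2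

theorem integrable_windowIntegral [SFinite μ] (hφ : Measurable φ) (δ : ℝ) (hG : Integrable G μ) :
    Integrable (windowIntegral μ φ δ G) := by
  rw [funext (windowIntegral_eq_integral_indicator hφ)]
  exact (integrable_indicator_window hφ δ hG).integral_prod_right

theorem fourierInv_windowIntegral [SFinite μ] (hφ : Measurable φ) (δ : ℝ) (hG : Integrable G μ)
    (t : ℝ) :
    𝓕⁻ (windowIntegral μ φ δ G) t =
      (∫ s in Set.Icc (-δ) δ, (Real.fourierChar (s * t) : ℂ)) *
        ∫ y, Real.fourierChar (φ y * t) * G y ∂μ := by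
  set F : α × ℝ → ℂ := {p : α × ℝ | |φ p.1 - p.2| ≤ δ}.indicator fun p => G p.1 with hF
  have hint : Integrable (fun p : α × ℝ => (Real.fourierChar (p.2 * t) : ℂ) * F p)
      (μ.prod volume) :=
    (integrable_indicator_window hφ δ hG).bdd_mul (c := 1) (by fun_prop)
      (.of_forall fun p => (Circle.norm_coe _).le)
  have hslice : ∀ y, ∫ τ, (Real.fourierChar (τ * t) : ℂ) * F (y, τ) =
      (∫ τ in Set.Icc (φ y - δ) (φ y + δ), (Real.fourierChar (τ * t) : ℂ)) * G y := fun y => by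
    rw [← integral_mul_const, ← integral_indicator measurableSet_Icc]
    refine integral_congr_ae (.of_forall fun τ => ?_)
    simp only [hF, ← setOf_abs_sub_le, Set.indicator_apply, Set.mem_ofPred_eq, mul_ite, mul_zero]
  have hshift : ∀ u, ∫ τ in Set.Icc (u - δ) (u + δ), (Real.fourierChar (τ * t) : ℂ) =
      Real.fourierChar (u * t) * ∫ s in Set.Icc (-δ) δ, (Real.fourierChar (s * t) : ℂ) := by
    intro u
    rw [← integral_const_mul, ← integral_indicator measurableSet_Icc,
      ← integral_indicator measurableSet_Icc, ← integral_add_left_eq_self _ u]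
    refine integral_congr_ae (.of_forall fun s => ?_)
    simp only [Set.indicator_apply, add_mul, AddChar.map_add_eq_mul, Circle.coe_mul, Set.mem_Icc,
      sub_eq_add_neg, add_le_add_iff_left]
  calc 𝓕⁻ (windowIntegral μ φ δ G) t
      = ∫ τ, ∫ y, (Real.fourierChar (τ * t) : ℂ) * F (y, τ) ∂μ := by
        rw [Real.fourierInv_eq]
        refine integral_congr_ae (.of_forall fun τ => ?_)
        simp only [windowIntegral_eq_integral_indicator hφ, integral_const_mul]
        simp [Circle.smul_def, mul_comm, hF]
    _ = ∫ y, ∫ τ, (Real.fourierChar (τ * t) : ℂ) * F (y, τ) ∂volume ∂μ :=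
        integral_integral_swap (f := fun τ y => (Real.fourierChar (τ * t) : ℂ) * F (y, τ)) hint.swap
    _ = ∫ y, (∫ s in Set.Icc (-δ) δ, (Real.fourierChar (s * t) : ℂ)) *
          (Real.fourierChar (φ y * t) * G y) ∂μ := by
        simp only [hslice, hshift]
        congr 1 with y
        ring
    _ = _ := integral_const_mul _ _

theorem enorm_fourierChar_integral_ge {t : ℝ} (ht : |t| ≤ 1) :
    ENNReal.ofReal (1 / 6) ≤
      ‖∫ s in Set.Icc (-(1 / 6) : ℝ) (1 / 6), (Real.fourierChar (s * t) : ℂ)‖ₑ := by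
  have hre : ∀ s ∈ Set.Icc (-(1 / 6) : ℝ) (1 / 6),
      1 / 2 ≤ ((Real.fourierChar (s * t) : ℂ)).re := fun s hs => by
    have habs : |2 * Real.pi * (s * t)| ≤ Real.pi / 3 := by
      rw [abs_mul, abs_mul s, abs_of_pos Real.two_pi_pos]
      nlinarith [Real.pi_pos, abs_le.2 hs, abs_nonneg s, abs_nonneg t,
        mul_le_mul (abs_le.2 hs) ht (abs_nonneg t) (by norm_num)]
    rw [Real.fourierChar_apply, Complex.exp_ofReal_mul_I_re, ← Real.cos_pi_div_three,
      ← Real.cos_abs (2 * Real.pi * (s * t))]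
    exact Real.cos_le_cos_of_nonneg_of_le_pi (abs_nonneg _) (by linarith [Real.pi_pos]) habs
  have hint : IntegrableOn (fun s : ℝ => (Real.fourierChar (s * t) : ℂ))
      (Set.Icc (-(1 / 6)) (1 / 6)) :=
    (by fun_prop : Continuous fun s : ℝ => (Real.fourierChar (s * t) : ℂ)).integrableOn_Icc
  have hlower : (1 / 6 : ℝ) ≤
      (∫ s in Set.Icc (-(1 / 6) : ℝ) (1 / 6), (Real.fourierChar (s * t) : ℂ)).re := by
    calc (1 / 6 : ℝ) = ∫ s in Set.Icc (-(1 / 6) : ℝ) (1 / 6), (1 / 2 : ℝ) := by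
          rw [setIntegral_const, Real.volume_real_Icc]
          norm_num
      _ ≤ ∫ s in Set.Icc (-(1 / 6) : ℝ) (1 / 6), ((Real.fourierChar (s * t) : ℂ)).re :=
          setIntegral_mono_on (integrable_const _) hint.re measurableSet_Icc hre
      _ = _ := integral_re hint
  rw [← ofReal_norm]
  exact ENNReal.ofReal_le_ofReal (hlower.trans (Complex.re_le_norm _))

theorem lintegral_sq_windowIntegral_le [SFinite μ] (hφ : Measurable φ) (hG : Integrable G μ)
    {D : ℝ≥0} (hD : ∀ τ, μ {y | G y ≠ 0 ∧ |φ y - τ| ≤ δ} ≤ D) :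
    ∫⁻ τ, ‖windowIntegral μ φ δ G τ‖ₑ ^ 2 ≤
      ENNReal.ofReal (2 * δ) * D * ∫⁻ y, ‖G y‖ₑ ^ 2 ∂μ := by
  have hpoint : ∀ τ, ‖windowIntegral μ φ δ G τ‖ₑ ^ 2 ≤
      D * ∫⁻ y in {y | |φ y - τ| ≤ δ}, ‖G y‖ₑ ^ 2 ∂μ := fun τ => by
    have hW : MeasurableSet {y | |φ y - τ| ≤ δ} :=
      measurable_prodMk_right (measurableSet_window hφ δ)
    refine (enorm_integral_sq_le hG.aestronglyMeasurable.restrict).trans ?_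
    gcongr
    rw [Measure.restrict_apply' hW]
    exact hD τ
  calc ∫⁻ τ, ‖windowIntegral μ φ δ G τ‖ₑ ^ 2
      ≤ ∫⁻ τ, D * ∫⁻ y in {y | |φ y - τ| ≤ δ}, ‖G y‖ₑ ^ 2 ∂μ := lintegral_mono hpoint
    _ = D * ∫⁻ τ, ∫⁻ y in {y | |φ y - τ| ≤ δ}, ‖G y‖ₑ ^ 2 ∂μ :=
        lintegral_const_mul' _ _ ENNReal.coe_ne_top
    _ = ENNReal.ofReal (2 * δ) * D * ∫⁻ y, ‖G y‖ₑ ^ 2 ∂μ := by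
        rw [lintegral_lintegral_window hφ δ (hG.aestronglyMeasurable.enorm.pow_const 2)]
        ring

theorem lintegral_sq_oscillatory_le [SFinite μ] (hφ : Measurable φ) (hG : Integrable G μ)
    {D : ℝ≥0} (hD : ∀ τ, μ {y | G y ≠ 0 ∧ |φ y - τ| ≤ 1 / 6} ≤ D) :
    ∫⁻ t in Set.Icc (0 : ℝ) 1, ‖∫ y, Real.fourierChar (φ y * t) * G y ∂μ‖ₑ ^ 2 ≤
      12 * D * ∫⁻ y, ‖G y‖ₑ ^ 2 ∂μ := by
  have hpoint : ∀ t ∈ Set.Icc (0 : ℝ) 1, ‖∫ y, Real.fourierChar (φ y * t) * G y ∂μ‖ₑ ^ 2 ≤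
      36 * ‖𝓕⁻ (windowIntegral μ φ (1 / 6) G) t‖ₑ ^ 2 := fun t ht => by
    have hker := enorm_fourierChar_integral_ge (abs_le.2 ⟨by linarith [ht.1], ht.2⟩)
    rw [fourierInv_windowIntegral hφ _ hG, enorm_mul, mul_pow, ← mul_assoc]
    refine le_mul_of_one_le_left' ?_
    calc (1 : ℝ≥0∞) = 36 * ENNReal.ofReal (1 / 6) ^ 2 := by
          rw [← ENNReal.ofReal_pow (by norm_num), ← ENNReal.ofReal_ofNat,
            ← ENNReal.ofReal_mul (by norm_num)]
          norm_num
      _ ≤ _ := by gcongr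
  calc ∫⁻ t in Set.Icc (0 : ℝ) 1, ‖∫ y, Real.fourierChar (φ y * t) * G y ∂μ‖ₑ ^ 2
      ≤ ∫⁻ t in Set.Icc (0 : ℝ) 1, 36 * ‖𝓕⁻ (windowIntegral μ φ (1 / 6) G) t‖ₑ ^ 2 :=
        setLIntegral_mono' measurableSet_Icc hpoint
    _ ≤ ∫⁻ t, 36 * ‖𝓕⁻ (windowIntegral μ φ (1 / 6) G) t‖ₑ ^ 2 := setLIntegral_le_lintegral _ _
    _ = 36 * ∫⁻ t, ‖𝓕⁻ (windowIntegral μ φ (1 / 6) G) t‖ₑ ^ 2 :=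
        lintegral_const_mul' _ _ (by norm_num)
    _ ≤ 36 * (ENNReal.ofReal (2 * (1 / 6)) * D * ∫⁻ y, ‖G y‖ₑ ^ 2 ∂μ) := by
        gcongr
        exact (lintegral_sq_fourierInv_le (integrable_windowIntegral hφ _ hG)).trans
          (lintegral_sq_windowIntegral_le hφ hG hD)
    _ = 12 * D * ∫⁻ y, ‖G y‖ₑ ^ 2 ∂μ := by
        rw [← mul_assoc, ← mul_assoc, ← ENNReal.ofReal_ofNat, ← ENNReal.ofReal_mul (by norm_num)]
        norm_num

end Window

section Bilinear

/-- The function `a` on a frequency space, evolved up to time `t` by rotating the frequency `y` with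
speed `φ y`. -/
noncomputable def evolve {Γ : Type*} (φ : Γ → ℝ) (t : ℝ) (a : Γ → ℂ) (y : Γ) : ℂ :=
  Real.fourierChar (φ y * t) * a y

theorem integrable_evolve {Γ : Type*} [MeasurableSpace Γ] {μ : Measure Γ} {φ : Γ → ℝ} {a : Γ → ℂ}
    (hφ : Measurable φ) (t : ℝ) (ha : Integrable a μ) : Integrable (evolve φ t a) μ :=
  ha.bdd_mul (c := 1) (by fun_prop) (.of_forall fun y => (Circle.norm_coe _).le)

theorem evolve_convolution_evolve {Γ : Type*} [AddGroup Γ] [MeasurableSpace Γ] (μ : Measure Γ)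
    (φ : Γ → ℝ) (a b : Γ → ℂ) (t : ℝ) (x : Γ) :
    (evolve φ t b ⋆[ContinuousLinearMap.mul ℂ ℂ, μ] evolve φ t a) x =
      ∫ y, Real.fourierChar ((φ y + φ (x - y)) * t) * (b y * a (x - y)) ∂μ := by
  simp only [convolution, evolve, ContinuousLinearMap.mul_apply']
  congr 1 with y
  rw [add_mul, AddChar.map_add_eq_mul, Circle.coe_mul]
  ring

variable {Γ : Type*} [AddGroup Γ] [MeasurableSpace Γ] [MeasurableAdd₂ Γ] [MeasurableNeg Γ]
  {μ : Measure Γ} [SFinite μ] {φ : Γ → ℝ} {a b : Γ → ℂ}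

theorem measurable_evolve_convolution_evolve (hφ : Measurable φ) (ha : Measurable a)
    (hb : Measurable b) :
    Measurable fun p : ℝ × Γ =>
      (evolve φ p.1 b ⋆[ContinuousLinearMap.mul ℂ ℂ, μ] evolve φ p.1 a) p.2 := by
  simp only [convolution, evolve, ContinuousLinearMap.mul_apply']
  refine (StronglyMeasurable.integral_prod_right (f := fun (p : ℝ × Γ) (y : Γ) =>
    (Real.fourierChar (φ y * p.1) * b y : ℂ) *
      (Real.fourierChar (φ (p.2 - y) * p.1) * a (p.2 - y))) ?_).measurable
  exact Measurable.stronglyMeasurable (by fun_prop)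

theorem lintegral_lintegral_sq_mul_sub [μ.IsAddRightInvariant] (ha : Measurable a)
    (hb : Measurable b) :
    ∫⁻ x, ∫⁻ y, ‖b y * a (x - y)‖ₑ ^ 2 ∂μ ∂μ = (∫⁻ y, ‖b y‖ₑ ^ 2 ∂μ) * ∫⁻ y, ‖a y‖ₑ ^ 2 ∂μ := by
  have hm : Measurable fun p : Γ × Γ => ‖b p.2 * a (p.1 - p.2)‖ₑ ^ 2 := by fun_prop
  rw [lintegral_lintegral_swap hm.aemeasurable, ← lintegral_mul_const _ (by fun_prop)]
  refine lintegral_congr fun y => ?_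
  simp only [enorm_mul, mul_pow]
  rw [lintegral_const_mul _ (by fun_prop),
    lintegral_sub_right_eq_self (fun x => ‖a x‖ₑ ^ 2) y]

theorem lintegral_sq_evolve_convolution_le [μ.IsAddRightInvariant] (hφ : Measurable φ)
    (ha : Measurable a) (hb : Measurable b) (ha' : Integrable a μ) (hb' : Integrable b μ) {D : ℝ≥0}
    (hD : ∀ x τ, μ {y | b y * a (x - y) ≠ 0 ∧ |φ y + φ (x - y) - τ| ≤ 1 / 6} ≤ D) :
    ∫⁻ t in Set.Icc (0 : ℝ) 1, ∫⁻ x,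
        ‖(evolve φ t b ⋆[ContinuousLinearMap.mul ℂ ℂ, μ] evolve φ t a) x‖ₑ ^ 2 ∂μ ≤
      12 * D * ((∫⁻ y, ‖b y‖ₑ ^ 2 ∂μ) * ∫⁻ y, ‖a y‖ₑ ^ 2 ∂μ) := by
  rw [lintegral_lintegral_swap
    ((measurable_evolve_convolution_evolve hφ ha hb).enorm.pow_const 2).aemeasurable]
  calc _ ≤ ∫⁻ x, 12 * D * ∫⁻ y, ‖b y * a (x - y)‖ₑ ^ 2 ∂μ ∂μ := by
        refine lintegral_mono_ae ?_
        filter_upwards [hb'.ae_convolution_exists (ContinuousLinearMap.mul ℂ ℂ) ha'] with x hx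
        simp only [evolve_convolution_evolve]
        exact lintegral_sq_oscillatory_le (by fun_prop) hx (hD x)
    _ = _ := by
        rw [lintegral_const_mul' _ _ (by finiteness), lintegral_lintegral_sq_mul_sub ha hb]

end Bilinear

section Hyperbola

theorem volume_sq_near_le {a : ℝ} (ha : 0 ≤ a) (B : ℝ) :
    volume {x : ℝ | a ≤ x ∧ |x ^ 2 - B| ≤ 1} ≤
      ENNReal.ofReal (2 / √(max (a ^ 2) (B - 1) + 2)) := by
  set v := max (a ^ 2) (B - 1)
  have hv : 0 ≤ v := (sq_nonneg a).trans (le_max_left _ _)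
  have hsub : {x : ℝ | a ≤ x ∧ |x ^ 2 - B| ≤ 1} ⊆ Set.Icc (√v) (√(v + 2)) := by
    rintro x ⟨hax, hx⟩
    obtain ⟨hlow, hhigh⟩ := abs_le.1 hx
    exact ⟨Real.sqrt_le_iff.2 ⟨ha.trans hax, max_le (pow_le_pow_left₀ ha hax 2) (by linarith)⟩,
      Real.le_sqrt_of_sq_le (by linarith [le_max_right (a ^ 2) (B - 1)])⟩
  refine (measure_mono hsub).trans ?_
  rw [Real.volume_Icc]
  refine ENNReal.ofReal_le_ofReal ?_
  have hpos : 0 < √(v + 2) := Real.sqrt_pos.2 (by linarith)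
  rw [le_div_iff₀ hpos]
  nlinarith [Real.sqrt_nonneg v, Real.sq_sqrt hv, Real.sq_sqrt (by linarith : 0 ≤ v + 2),
    Real.sqrt_le_sqrt (by linarith : v ≤ v + 2)]

theorem volume_sq_near_le_two (B : ℝ) : volume {x : ℝ | 0 ≤ x ∧ |x ^ 2 - B| ≤ 1} ≤ 2 := by
  have hone : 1 ≤ √(max (0 ^ 2) (B - 1) + 2) :=
    Real.one_le_sqrt.2 (by linarith [le_max_left ((0 : ℝ) ^ 2) (B - 1)])
  refine (volume_sq_near_le le_rfl B).trans ?_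
  rw [← ENNReal.ofReal_ofNat 2]
  exact ENNReal.ofReal_le_ofReal (div_le_self zero_le_two hone)

theorem volume_sq_near_le_div {M : ℝ} (hM : 0 < M) (B : ℝ) :
    volume {x : ℝ | M ≤ |x| ∧ |x ^ 2 - B| ≤ 1} ≤ ENNReal.ofReal (4 / M) := by
  set E : Set ℝ := {x | M ≤ x ∧ |x ^ 2 - B| ≤ 1}
  have hE : volume E ≤ ENNReal.ofReal (2 / M) := by
    refine (volume_sq_near_le hM.le B).trans (ENNReal.ofReal_le_ofReal ?_)
    gcongr
    exact Real.le_sqrt_of_sq_le (by linarith [le_max_left (M ^ 2) (B - 1)])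
  have hsub : {x : ℝ | M ≤ |x| ∧ |x ^ 2 - B| ≤ 1} ⊆ E ∪ -E := by
    rintro x ⟨hx, hxB⟩
    exact (le_abs.1 hx).imp (⟨·, hxB⟩) (⟨·, by rwa [neg_sq]⟩)
  calc _ ≤ volume E + volume (-E) := (measure_mono hsub).trans (measure_union_le _ _)
    _ ≤ ENNReal.ofReal (2 / M) + ENNReal.ofReal (2 / M) := by
        rw [Measure.measure_neg]
        gcongr
    _ = ENNReal.ofReal (4 / M) := by
        rw [← ENNReal.ofReal_add (by positivity) (by positivity)]
        ring_nf

theorem two_div_sqrt_le {v d : ℝ} (hd : 0 < d) (hv : d ≤ v) :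
    2 / √v ≤ 4 / d * (√v - √(v - d)) := by
  have hpos : 0 < √v := Real.sqrt_pos.2 (hd.trans_le hv)
  rw [div_mul_eq_mul_div, div_le_div_iff₀ hpos hd]
  nlinarith [Real.sq_sqrt (hd.le.trans hv), Real.sq_sqrt (sub_nonneg.2 hv),
    sq_nonneg (√v - √(v - d))]

theorem pairwise_disjoint_Ioc_sqrt {ι : Type*} {s : Set ι} {B : ι → ℝ} {d : ℝ}
    (hB : s.Pairwise fun i j => d ≤ |B i - B j|) :
    s.PairwiseDisjoint fun i => Set.Ioc (√(B i - d)) (√(B i)) := by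
  have key : ∀ {u v : ℝ}, d ≤ u - v →
      Disjoint (Set.Ioc (√(u - d)) (√u)) (Set.Ioc (√(v - d)) (√v)) := fun h =>
    Set.disjoint_left.2 fun x hx hx' =>
      (hx.1.trans_le hx'.2).not_ge (Real.sqrt_le_sqrt (by linarith))
  intro i hi j hj hij
  rcases le_abs.1 (hB hi hj hij) with h | h
  · exact key h
  · exact (key (by linarith)).symm

theorem volume_sq_near_inter_le {B d a ρ : ℝ} (hd : 0 < d) (ha : 0 ≤ a) :
    volume {x : ℝ | (a ≤ x ∧ x ≤ a + 2 * ρ) ∧ |x ^ 2 - B| ≤ 1} ≤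
      (if a ^ 2 - 1 ≤ B ∧ B < a ^ 2 - 1 + d then 2 else 0) +
        ENNReal.ofReal (4 / d) *
          volume (Set.Ioc (√(B + 1 - d)) (√(B + 1)) ∩ Set.Icc a (a + 2 * ρ + 2)) := by
  rcases Set.eq_empty_or_nonempty {x : ℝ | (a ≤ x ∧ x ≤ a + 2 * ρ) ∧ |x ^ 2 - B| ≤ 1} with
    hempty | ⟨x₀, ⟨hax, hxa⟩, hx⟩
  · simp [hempty]
  obtain ⟨hlow, hhigh⟩ := abs_le.1 hx
  have haB : a ^ 2 - 1 ≤ B := by nlinarith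
  split_ifs with hB
  · refine le_add_right ((measure_mono fun x hx => ?_).trans (volume_sq_near_le_two B))
    exact ⟨ha.trans hx.1.1, hx.2⟩
  replace hB : a ^ 2 - 1 + d ≤ B := not_lt.1 fun h => hB ⟨haB, h⟩
  have hinter : Set.Ioc (√(B + 1 - d)) (√(B + 1)) ∩ Set.Icc a (a + 2 * ρ + 2) =
      Set.Ioc (√(B + 1 - d)) (√(B + 1)) := by
    refine Set.inter_eq_left.2 fun x hx => ⟨?_, hx.2.trans (Real.sqrt_le_iff.2 ⟨?_, ?_⟩)⟩
    · exact (Real.le_sqrt_of_sq_le (by linarith)).trans hx.1.le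
    · linarith
    · nlinarith
  rw [zero_add, hinter, Real.volume_Ioc, ← ENNReal.ofReal_mul (by positivity)]
  calc _ ≤ volume {x : ℝ | 0 ≤ x ∧ |x ^ 2 - B| ≤ 1} :=
        measure_mono fun x hx => ⟨ha.trans hx.1.1, hx.2⟩
    _ ≤ ENNReal.ofReal (2 / √(max (0 ^ 2) (B - 1) + 2)) := volume_sq_near_le le_rfl B
    _ ≤ ENNReal.ofReal (2 / √(B + 1)) := by
        have hpos : 0 < √(B + 1) := Real.sqrt_pos.2 (by nlinarith)
        refine ENNReal.ofReal_le_ofReal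
          (div_le_div_of_nonneg_left zero_le_two hpos (Real.sqrt_le_sqrt ?_))
        linarith [le_max_right ((0 : ℝ) ^ 2) (B - 1)]
    _ ≤ _ := ENNReal.ofReal_le_ofReal (two_div_sqrt_le hd (by nlinarith))

theorem sum_volume_sq_near_nonneg_le {ι : Type*} {A : Finset ι} {B : ι → ℝ} {d ρ : ℝ} (hd : 0 < d)
    (hB : (A : Set ι).Pairwise fun i j => d ≤ |B i - B j|) (p : ℝ) (hρ : 0 ≤ ρ) :
    ∑ i ∈ A, volume {x : ℝ | 0 ≤ x ∧ |x - p| ≤ ρ ∧ |x ^ 2 - B i| ≤ 1} ≤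
      ENNReal.ofReal (2 + 4 / d * (2 * ρ + 2)) := by
  set a := max (p - ρ) 0
  have ha : 0 ≤ a := le_max_right _ _
  set F : ι → Set ℝ := fun i => Set.Ioc (√(B i + 1 - d)) (√(B i + 1)) ∩ Set.Icc a (a + 2 * ρ + 2)
  have hlow : (A.filter fun i => a ^ 2 - 1 ≤ B i ∧ B i < a ^ 2 - 1 + d).card ≤ 1 := by
    refine Finset.card_le_one.2 fun i hi j hj => by_contra fun hij => ?_
    obtain ⟨hiA, hi⟩ := Finset.mem_filter.1 hi
    obtain ⟨hjA, hj⟩ := Finset.mem_filter.1 hj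
    exact (hB hiA hjA hij).not_gt (abs_lt.2 ⟨by linarith, by linarith⟩)
  have hF : ∑ i ∈ A, volume (F i) ≤ ENNReal.ofReal (2 * ρ + 2) := by
    have hdisj : (A : Set ι).PairwiseDisjoint F :=
      (pairwise_disjoint_Ioc_sqrt (B := fun i => B i + 1) (by simpa using hB)).mono
        fun i => Set.inter_subset_left
    calc ∑ i ∈ A, volume (F i) = volume (⋃ i ∈ A, F i) :=
          (measure_biUnion_finset hdisj fun i _ => measurableSet_Ioc.inter measurableSet_Icc).symm
      _ ≤ volume (Set.Icc a (a + 2 * ρ + 2)) :=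
          measure_mono (Set.iUnion₂_subset fun i _ => Set.inter_subset_right)
      _ = _ := by rw [Real.volume_Icc]; ring_nf
  have hslice : ∀ i, {x : ℝ | 0 ≤ x ∧ |x - p| ≤ ρ ∧ |x ^ 2 - B i| ≤ 1} ⊆
      {x : ℝ | (a ≤ x ∧ x ≤ a + 2 * ρ) ∧ |x ^ 2 - B i| ≤ 1} := by
    rintro i x ⟨hx, hxp, hxB⟩
    obtain ⟨h₁, h₂⟩ := abs_le.1 hxp
    exact ⟨⟨max_le (by linarith) hx, by linarith [le_max_left (p - ρ) 0]⟩, hxB⟩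
  calc _ ≤ ∑ i ∈ A, ((if a ^ 2 - 1 ≤ B i ∧ B i < a ^ 2 - 1 + d then 2 else 0) +
          ENNReal.ofReal (4 / d) * volume (F i)) :=
        Finset.sum_le_sum fun i _ => (measure_mono (hslice i)).trans (volume_sq_near_inter_le hd ha)
    _ ≤ 2 + ENNReal.ofReal (4 / d) * ENNReal.ofReal (2 * ρ + 2) := by
        rw [Finset.sum_add_distrib, ← Finset.mul_sum, ← Finset.sum_filter, Finset.sum_const,
          nsmul_eq_mul]
        gcongr
        exact mul_le_of_le_one_left' (by exact_mod_cast hlow)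
    _ = _ := by
        rw [← ENNReal.ofReal_mul (by positivity), ← ENNReal.ofReal_ofNat 2,
          ← ENNReal.ofReal_add (by positivity) (by positivity)]

theorem sum_volume_sq_near_le {ι : Type*} {A : Finset ι} {B : ι → ℝ} {d ρ : ℝ} (hd : 0 < d)
    (hB : (A : Set ι).Pairwise fun i j => d ≤ |B i - B j|) (p : ℝ) (hρ : 0 ≤ ρ) :
    ∑ i ∈ A, volume {x : ℝ | |x - p| ≤ ρ ∧ |x ^ 2 - B i| ≤ 1} ≤
      ENNReal.ofReal (2 * (2 + 4 / d * (2 * ρ + 2))) := by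
  set E : ℝ → ι → Set ℝ := fun p i => {x | 0 ≤ x ∧ |x - p| ≤ ρ ∧ |x ^ 2 - B i| ≤ 1}
  have hsub : ∀ i, {x : ℝ | |x - p| ≤ ρ ∧ |x ^ 2 - B i| ≤ 1} ⊆ E p i ∪ -E (-p) i := by
    rintro i x ⟨hx, hxB⟩
    rcases le_total 0 x with h | h
    · exact Or.inl ⟨h, hx, hxB⟩
    · refine Or.inr ⟨neg_nonneg.2 h, ?_, by rwa [neg_sq]⟩
      rwa [sub_neg_eq_add, neg_add_eq_sub, abs_sub_comm]
  calc _ ≤ ∑ i ∈ A, (volume (E p i) + volume (E (-p) i)) :=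
        Finset.sum_le_sum fun i _ => (measure_mono (hsub i)).trans <|
          (measure_union_le _ _).trans_eq (by rw [Measure.measure_neg])
    _ ≤ ENNReal.ofReal (2 + 4 / d * (2 * ρ + 2)) + ENNReal.ofReal (2 + 4 / d * (2 * ρ + 2)) := by
        rw [Finset.sum_add_distrib]
        exact add_le_add (sum_volume_sq_near_nonneg_le hd hB p hρ)
          (sum_volume_sq_near_nonneg_le hd hB (-p) hρ)
    _ = _ := by rw [← two_mul, ENNReal.ofReal_mul zero_le_two, ENNReal.ofReal_ofNat]

end Hyperbola

section ResonantSet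

/-- The Haar measure on `ℤ × ℝ`, the dual group of `𝕋_L × ℝ`.  The frequency of `(k, η)` is
`ξ = (η, k / L)`: the discrete component comes first, the reverse of the order in `ℝ × 𝕋_L`. -/
noncomputable abbrev freqMeasure : Measure (ℤ × ℝ) := Measure.count.prod volume

theorem count_prod_le {ι β : Type*} [MeasurableSpace ι] [MeasurableSingletonClass ι] [Countable ι]
    [MeasurableSpace β] (ν : Measure β) [SFinite ν] (s : Set (ι × β)) :
    (Measure.count.prod ν) s ≤ ∑' i, ν (Prod.mk i ⁻¹' s) := by
  have hs : s = ⋃ i, {i} ×ˢ (Prod.mk i ⁻¹' s) := by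
    ext ⟨i, y⟩
    simp
  calc (Measure.count.prod ν) s = (Measure.count.prod ν) (⋃ i, {i} ×ˢ (Prod.mk i ⁻¹' s)) := by
        rw [← hs]
    _ ≤ ∑' i, (Measure.count.prod ν) ({i} ×ˢ (Prod.mk i ⁻¹' s)) := measure_iUnion_le _
    _ = ∑' i, ν (Prod.mk i ⁻¹' s) := by
        simp only [Measure.prod_prod, Measure.count_singleton, one_mul]

theorem pairwise_le_abs_sq_lattice_sub {A : Set ℤ} {L M q : ℝ} (hL : 0 < L) (c : ℝ)
    (hA : ∀ i ∈ A, ∀ j ∈ A, 2 * M ≤ |(i / L - q) + (j / L - q)|) :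
    A.Pairwise fun i j => 2 * M / L ≤ |((i / L - q) ^ 2 + c) - ((j / L - q) ^ 2 + c)| := by
  intro i hi j hj hij
  have hone : (1 : ℝ) ≤ |(i : ℝ) - j| := by exact_mod_cast Int.one_le_abs (sub_ne_zero.2 hij)
  calc 2 * M / L = 2 * M * (1 / L) := by ring
    _ ≤ |(i / L - q) + (j / L - q)| * (|(i : ℝ) - j| / L) :=
        mul_le_mul (hA i hi j hj) (by gcongr) (by positivity) (abs_nonneg _)
    _ = |(i / L - q) + (j / L - q)| * |((i : ℝ) - j) / L| := by rw [abs_div, abs_of_pos hL]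
    _ = _ := by
        rw [← abs_mul]
        congr 1
        ring

theorem sum_volume_hyperbola_slice_le {A : Finset ℤ} {L M ρ : ℝ} (hL : 0 < L) (hM : 0 < M)
    (hρ : 0 ≤ ρ) (p q c : ℝ) (hA : ∀ i ∈ A, ∀ j ∈ A, 2 * M ≤ |(i / L - q) + (j / L - q)|) :
    ∑ l ∈ A, volume {x : ℝ | |x| ≤ ρ ∧ |(x - p) ^ 2 - (l / L - q) ^ 2 - c| ≤ 1} ≤
      ENNReal.ofReal (2 * (2 + 2 * L / M * (2 * ρ + 2))) := by
  have hsep := pairwise_le_abs_sq_lattice_sub (A := A) hL c hA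
  have h := sum_volume_sq_near_le (by positivity) hsep (-p) hρ
  rw [show 4 / (2 * M / L) = 2 * L / M by field_simp; norm_num] at h
  refine le_of_eq_of_le (Finset.sum_congr rfl fun l _ => ?_) h
  refine Eq.trans ?_ (measure_preimage_add_right volume (-p) _)
  congr 1 with x
  simp only [Set.mem_preimage, Set.mem_ofPred_eq, ← sub_eq_add_neg, sub_neg_eq_add, sub_add_cancel,
    ← sub_sub]

theorem freqMeasure_hyperbola_far_fst_le {L M ρ : ℝ} (hL : 0 < L) (hM : 0 < M) (hρ : 0 ≤ ρ)
    (p q c : ℝ) :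
    freqMeasure {y | |y.2| ≤ ρ ∧ M ≤ |y.1 / L - q| ∧
        |(y.2 - p) ^ 2 - (y.1 / L - q) ^ 2 - c| ≤ 1} ≤
      ENNReal.ofReal (4 * (2 + 2 * L / M * (2 * ρ + 2))) := by
  set S : ℤ → Set ℝ := fun l => {x | |x| ≤ ρ ∧ |(x - p) ^ 2 - (l / L - q) ^ 2 - c| ≤ 1}
  have hslice : ∀ l : ℤ, volume {x : ℝ | |x| ≤ ρ ∧ M ≤ |l / L - q| ∧
      |(x - p) ^ 2 - (l / L - q) ^ 2 - c| ≤ 1} ≤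
        (if M ≤ l / L - q then volume (S l) else 0) +
          if M ≤ -(l / L - q) then volume (S l) else 0 := fun l => by
    by_cases hl : M ≤ |l / L - q|
    · have hS : volume {x : ℝ | |x| ≤ ρ ∧ M ≤ |l / L - q| ∧
          |(x - p) ^ 2 - (l / L - q) ^ 2 - c| ≤ 1} ≤ volume (S l) :=
        measure_mono fun x hx => ⟨hx.1, hx.2.2⟩
      rcases le_abs.1 hl with h | h
      · rw [if_pos h]
        exact le_add_right hS
      · rw [if_pos h]
        exact le_add_left hS
    · simp [hl]
  refine (count_prod_le _ _).trans ((ENNReal.tsum_le_tsum hslice).trans ?_)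
  refine ENNReal.tsum_eq_iSup_sum.trans_le (iSup_le fun A => ?_)
  rw [Finset.sum_add_distrib, ← Finset.sum_filter, ← Finset.sum_filter,
    show 4 * (2 + 2 * L / M * (2 * ρ + 2)) =
      2 * (2 + 2 * L / M * (2 * ρ + 2)) + 2 * (2 + 2 * L / M * (2 * ρ + 2)) by ring,
    ENNReal.ofReal_add (by positivity) (by positivity)]
  refine add_le_add (sum_volume_hyperbola_slice_le hL hM hρ p q c fun i hi j hj => ?_)
    (sum_volume_hyperbola_slice_le hL hM hρ p q c fun i hi j hj => ?_) <;>
    rw [Finset.mem_filter] at hi hj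
  · exact le_abs.2 (Or.inl (by linarith))
  · exact le_abs.2 (Or.inr (by linarith))

theorem mem_Icc_floor_of_abs_div_le {L ρ : ℝ} (hL : 0 < L) {l : ℤ} (hl : |l / L| ≤ ρ) :
    l ∈ Finset.Icc (-⌊ρ * L⌋) ⌊ρ * L⌋ := by
  rw [abs_div, abs_of_pos hL, div_le_iff₀ hL, abs_le] at hl
  exact Finset.mem_Icc.2 ⟨neg_le.1 (Int.le_floor.2 (by push_cast; linarith)), Int.le_floor.2 hl.2⟩

theorem tsum_ite_abs_div_le {L ρ : ℝ} (hL : 0 < L) (hρ : 0 ≤ ρ) :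
    ∑' l : ℤ, (if |l / L| ≤ ρ then (1 : ℝ≥0∞) else 0) ≤ ENNReal.ofReal (2 * ρ * L + 1) := by
  have hfloor : 0 ≤ ⌊ρ * L⌋ := Int.floor_nonneg.2 (by positivity)
  rw [tsum_eq_sum (s := Finset.Icc (-⌊ρ * L⌋) ⌊ρ * L⌋)
    fun l hl => if_neg fun h => hl (mem_Icc_floor_of_abs_div_le hL h)]
  calc _ ≤ ∑ _l ∈ Finset.Icc (-⌊ρ * L⌋) ⌊ρ * L⌋, (1 : ℝ≥0∞) :=
        Finset.sum_le_sum fun l _ => by split_ifs <;> simp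
    _ = ENNReal.ofReal (2 * ⌊ρ * L⌋ + 1) := by
        rw [Finset.sum_const, Int.card_Icc, nsmul_one, ← ENNReal.ofReal_natCast]
        congr 1
        have h : ((⌊ρ * L⌋ + 1 - -⌊ρ * L⌋).toNat : ℤ) = 2 * ⌊ρ * L⌋ + 1 := by omega
        exact_mod_cast h
    _ ≤ _ := ENNReal.ofReal_le_ofReal (by linarith [Int.floor_le (ρ * L)])

theorem freqMeasure_hyperbola_far_snd_le {L M ρ : ℝ} (hL : 0 < L) (hM : 0 < M) (hρ : 0 ≤ ρ)
    (p q c : ℝ) :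
    freqMeasure {y | |y.1 / L| ≤ ρ ∧ M ≤ |y.2 - p| ∧
        |(y.2 - p) ^ 2 - (y.1 / L - q) ^ 2 - c| ≤ 1} ≤
      ENNReal.ofReal ((2 * ρ * L + 1) * (4 / M)) := by
  have hslice : ∀ l : ℤ, volume {x : ℝ | |l / L| ≤ ρ ∧ M ≤ |x - p| ∧
      |(x - p) ^ 2 - (l / L - q) ^ 2 - c| ≤ 1} ≤
        (if |l / L| ≤ ρ then 1 else 0) * ENNReal.ofReal (4 / M) := fun l => by
    split_ifs with hl
    · rw [one_mul]
      refine le_trans ?_ (volume_sq_near_le_div hM ((l / L - q) ^ 2 + c))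
      rw [← measure_preimage_add_right volume (-p) {x | M ≤ |x| ∧ _}]
      exact measure_mono fun x hx =>
        ⟨hx.2.1, by simpa only [sub_eq_add_neg, neg_add, ← add_assoc] using hx.2.2⟩
    · simp [hl]
  calc _ ≤ ∑' l : ℤ, (if |l / L| ≤ ρ then 1 else 0) * ENNReal.ofReal (4 / M) :=
        (count_prod_le _ _).trans (ENNReal.tsum_le_tsum hslice)
    _ ≤ _ := by
        rw [ENNReal.tsum_mul_right, ENNReal.ofReal_mul (by positivity)]
        gcongr
        exact tsum_ite_abs_div_le hL hρ

theorem freqMeasure_hyperbola_far_le {L M ρ : ℝ} (hL : 0 < L) (hρ : 1 ≤ ρ) (hM : ρ ≤ 4 * M)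
    (p q c : ℝ) :
    freqMeasure {y | (|y.1 / L| ≤ ρ ∧ |y.2| ≤ ρ) ∧ (M ≤ |y.1 / L - q| ∨ M ≤ |y.2 - p|) ∧
        |(y.2 - p) ^ 2 - (y.1 / L - q) ^ 2 - c| ≤ 1} ≤
      ENNReal.ofReal (40 * (1 + ρ * L / M)) := by
  have hρ' : 0 < ρ := by linarith
  have hM' : 0 < M := by linarith
  calc _ ≤ ENNReal.ofReal (4 * (2 + 2 * L / M * (2 * ρ + 2))) +
          ENNReal.ofReal ((2 * ρ * L + 1) * (4 / M)) := by
        refine (measure_mono ?_).trans ((measure_union_le _ _).trans (add_le_add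
          (freqMeasure_hyperbola_far_fst_le hL hM' hρ'.le p q c)
          (freqMeasure_hyperbola_far_snd_le hL hM' hρ'.le p q c)))
        rintro y ⟨⟨h₁, h₂⟩, hfar, hy⟩
        exact hfar.imp (⟨h₂, ·, hy⟩) (⟨h₁, ·, hy⟩)
    _ ≤ _ := by
        rw [← ENNReal.ofReal_add (by positivity) (by positivity)]
        refine ENNReal.ofReal_le_ofReal ?_
        have hinv : 1 / M ≤ 4 := by
          rw [div_le_iff₀ hM']
          linarith
        have hLM : L / M ≤ ρ * L / M := by
          gcongr
          exact le_mul_of_one_le_left hL.le hρ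
        linear_combination 4 * hinv + 16 * hLM

/-- The speed `2π(ξ₂² - ξ₁²)` at which `e^{it□}` rotates the frequency `ξ = (y.2, y.1 / L)`. -/
noncomputable def hyperbolicPhase (L : ℝ) (y : ℤ × ℝ) : ℝ :=
  2 * Real.pi * ((y.1 / L) ^ 2 - y.2 ^ 2)

theorem measurable_hyperbolicPhase (L : ℝ) : Measurable (hyperbolicPhase L) := by
  unfold hyperbolicPhase
  fun_prop

/-- The size `|ξ|` of the frequency `ξ = (y.2, y.1 / L)`. -/
noncomputable def freqSize (L : ℝ) (y : ℤ × ℝ) : ℝ := √(y.2 ^ 2 + (y.1 / L) ^ 2)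

theorem abs_div_le_freqSize (L : ℝ) (y : ℤ × ℝ) : |y.1 / L| ≤ freqSize L y :=
  Real.abs_le_sqrt (le_add_of_nonneg_left (sq_nonneg _))

theorem abs_snd_le_freqSize (L : ℝ) (y : ℤ × ℝ) : |y.2| ≤ freqSize L y :=
  Real.abs_le_sqrt (le_add_of_nonneg_right (sq_nonneg _))

-- In centred coordinates `u = y - x / 2` the sum of the two phases is quadratic in `u`.
theorem hyperbolicPhase_add_hyperbolicPhase_sub (L : ℝ) (x y : ℤ × ℝ) :
    hyperbolicPhase L y + hyperbolicPhase L (x - y) =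
      -(4 * Real.pi) * ((y.2 - x.2 / 2) ^ 2 - (y.1 / L - x.1 / (2 * L)) ^ 2 +
        ((x.2 / 2) ^ 2 - (x.1 / (2 * L)) ^ 2)) := by
  simp only [hyperbolicPhase, Prod.fst_sub, Prod.snd_sub, Int.cast_sub]
  ring

theorem le_abs_or_le_abs_of_freqSize {L ρ σ : ℝ} (hσ : 2 * ρ ≤ σ) (hρ : 0 ≤ ρ) {x y : ℤ × ℝ}
    (hy : freqSize L y ≤ ρ) (hxy : σ ≤ freqSize L (x - y)) :
    σ / 8 ≤ |y.1 / L - x.1 / (2 * L)| ∨ σ / 8 ≤ |y.2 - x.2 / 2| := by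
  by_contra! h
  have hlow : y.2 ^ 2 + (y.1 / L) ^ 2 ≤ ρ ^ 2 := (Real.sqrt_le_left hρ).1 hy
  have hhigh : σ ^ 2 ≤ (x - y).2 ^ 2 + ((x - y).1 / L) ^ 2 :=
    (Real.le_sqrt (by linarith) (by positivity)).1 hxy
  have hu := sq_lt_sq' (abs_lt.1 h.1).1 (abs_lt.1 h.1).2
  have hv := sq_lt_sq' (abs_lt.1 h.2).1 (abs_lt.1 h.2).2
  have hsub : (x - y).2 = y.2 - 2 * (y.2 - x.2 / 2) ∧
      (x - y).1 / L = y.1 / L - 2 * (y.1 / L - x.1 / (2 * L)) := by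
    constructor <;> simp only [Prod.fst_sub, Prod.snd_sub, Int.cast_sub] <;> ring
  rw [hsub.1, hsub.2] at hhigh
  nlinarith [sq_nonneg (y.2 + 2 * (y.2 - x.2 / 2)),
    sq_nonneg (y.1 / L + 2 * (y.1 / L - x.1 / (2 * L)))]

theorem freqMeasure_resonant_le {L ρ σ : ℝ} (hL : 0 < L) (hρ : 1 ≤ ρ) (hσ : 2 * ρ ≤ σ)
    (x : ℤ × ℝ) (τ : ℝ) :
    freqMeasure {y | freqSize L y ≤ ρ ∧ σ ≤ freqSize L (x - y) ∧
        |hyperbolicPhase L y + hyperbolicPhase L (x - y) - τ| ≤ 1 / 6} ≤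
      ENNReal.ofReal (320 * (1 + ρ * L / σ)) := by
  have hσ' : 0 < σ := by linarith
  set p := x.2 / 2
  set q := x.1 / (2 * L)
  set c := q ^ 2 - p ^ 2 - τ / (4 * Real.pi)
  refine (measure_mono ?_).trans
    ((freqMeasure_hyperbola_far_le (M := σ / 8) hL hρ (by linarith) p q c).trans ?_)
  · rintro y ⟨hy, hxy, hτ⟩
    refine ⟨⟨(abs_div_le_freqSize L y).trans hy, (abs_snd_le_freqSize L y).trans hy⟩,
      le_abs_or_le_abs_of_freqSize hσ (by linarith) hy hxy, ?_⟩
    rw [hyperbolicPhase_add_hyperbolicPhase_sub, show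
      -(4 * Real.pi) * ((y.2 - p) ^ 2 - (y.1 / L - q) ^ 2 + (p ^ 2 - q ^ 2)) - τ =
        -(4 * Real.pi * ((y.2 - p) ^ 2 - (y.1 / L - q) ^ 2 - c)) by
        simp only [c]
        field_simp
        ring, abs_neg, abs_mul, abs_of_pos (by positivity)] at hτ
    nlinarith [Real.pi_gt_three, abs_nonneg ((y.2 - p) ^ 2 - (y.1 / L - q) ^ 2 - c)]
  · refine ENNReal.ofReal_le_ofReal ?_
    have hdiv : ρ * L / (σ / 8) = 8 * (ρ * L / σ) := by field_simp
    rw [hdiv]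
    linarith

end ResonantSet

section CircleSeries

variable {L : ℝ} [Fact (0 < L)]

theorem fourierCoeff_eq_const_mul_integral (g : AddCircle L → ℂ) (k : ℤ) :
    fourierCoeff g k = (1 / L : ℂ) * ∫ x, fourier (-k) x * g x := by
  rw [fourierCoeff, AddCircle.integral_haarAddCircle, Complex.real_smul]
  simp

theorem fourierCoeff_tsum_fourier {c : ℤ → ℂ} (hc : Summable fun k => ‖c k‖) (j : ℤ) :
    fourierCoeff (fun x : AddCircle L => ∑' k, fourier k x * c k) j = c j := by
  have hint : ∀ k, Integrable (fun x : AddCircle L => fourier (-j) x • (fourier k x * c k))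
      AddCircle.haarAddCircle := fun k =>
    (by fun_prop : Continuous fun x : AddCircle L =>
      fourier (-j) x • (fourier k x * c k)).integrable_of_hasCompactSupport
        (HasCompactSupport.of_compactSpace _)
  have hnorm : ∀ k (x : AddCircle L), ‖fourier (-j) x • (fourier k x * c k)‖ = ‖c k‖ :=
    fun k x => by
      rw [norm_smul, norm_mul, fourier_apply, fourier_apply, Circle.norm_coe, Circle.norm_coe,
        one_mul, one_mul]
  have hcoeff : ∀ k, ∫ x : AddCircle L, fourier (-j) x • (fourier k x * c k)
      ∂AddCircle.haarAddCircle = (Pi.single k 1 : ℤ → ℂ) j * c k := fun k => by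
    rw [← fourierCoeff_fourier (T := L), mul_comm, ← fourierCoeff.const_mul]
    simp only [fourierCoeff, mul_comm (c k)]
  calc fourierCoeff (fun x : AddCircle L => ∑' k, fourier k x * c k) j
      = ∫ x : AddCircle L, ∑' k, fourier (-j) x • (fourier k x * c k)
          ∂AddCircle.haarAddCircle := by
        simp only [fourierCoeff, smul_eq_mul, tsum_mul_left]
    _ = ∑' k, (Pi.single k 1 : ℤ → ℂ) j * c k := by
        rw [← integral_tsum_of_summable_integral_norm hint <| by
          simpa only [hnorm, integral_const, probReal_univ, one_smul] using hc]
        simp only [hcoeff]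
    _ = c j := by
        rw [tsum_eq_single j fun k hk => by simp [Pi.single_eq_of_ne hk.symm]]
        simp

theorem lintegral_sq_eq_tsum_fourierCoeff {g : AddCircle L → ℂ} (hg : MemLp g 2 volume) :
    ∫⁻ x, ‖g x‖ₑ ^ 2 = ENNReal.ofReal L * ∑' k : ℤ, ‖fourierCoeff g k‖ₑ ^ 2 := by
  have hg' : MemLp g 2 AddCircle.haarAddCircle := hg.haarAddCircle
  have hParseval := hasSum_sq_fourierCoeff (hg'.toLp g)
  rw [fourierCoeff_congr_ae hg'.coeFn_toLp,
    integral_congr_ae (hg'.coeFn_toLp.mono fun x hx => congrArg (‖·‖ ^ 2) hx)] at hParseval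
  have hint : Integrable (fun x => ‖g x‖ ^ 2) AddCircle.haarAddCircle :=
    (memLp_two_iff_integrable_sq_norm hg'.1).1 hg'
  rw [AddCircle.volume_eq_smul_haarAddCircle, lintegral_smul_measure, smul_eq_mul]
  congr 1
  simp only [← ofReal_norm, ← ENNReal.ofReal_pow (norm_nonneg _)]
  rw [← ofReal_integral_eq_lintegral_ofReal hint (.of_forall fun _ => by positivity),
    ← hParseval.tsum_eq, ENNReal.ofReal_tsum_of_nonneg (fun _ => by positivity) hParseval.summable]

theorem lintegral_sq_tsum_fourier {c : ℤ → ℂ} (hc : Summable fun k => ‖c k‖) :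
    ∫⁻ x : AddCircle L, ‖∑' k, fourier k x * c k‖ₑ ^ 2 =
      ENNReal.ofReal L * ∑' k, ‖c k‖ₑ ^ 2 := by
  have hcont : Continuous fun x : AddCircle L => ∑' k, fourier k x * c k :=
    continuous_tsum (fun k => by fun_prop) hc fun k x => by
      rw [norm_mul, fourier_apply, Circle.norm_coe, one_mul]
  rw [lintegral_sq_eq_tsum_fourierCoeff
    (hcont.memLp_of_hasCompactSupport (HasCompactSupport.of_compactSpace _))]
  simp only [fourierCoeff_tsum_fourier hc]

end CircleSeries

section CylinderFourier

variable {L : ℝ}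

/-- The character of `ℝ × 𝕋_L` with frequency `(y.2, y.1 / L)`. -/
noncomputable def cylCharacter (L : ℝ) (x : ℝ × AddCircle L) (y : ℤ × ℝ) : ℂ :=
  fourier y.1 x.2 * Real.fourierChar (y.2 * x.1)

theorem cylCharacter_add (x : ℝ × AddCircle L) (y z : ℤ × ℝ) :
    cylCharacter L x (y + z) = cylCharacter L x y * cylCharacter L x z := by
  simp only [cylCharacter, Prod.fst_add, Prod.snd_add, fourier_add, add_mul,
    AddChar.map_add_eq_mul, Circle.coe_mul]
  ring

theorem norm_cylCharacter (x : ℝ × AddCircle L) (y : ℤ × ℝ) : ‖cylCharacter L x y‖ = 1 := by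
  rw [cylCharacter, norm_mul, fourier_apply, Circle.norm_coe, Circle.norm_coe, one_mul]

theorem measurable_cylCharacter (x : ℝ × AddCircle L) : Measurable (cylCharacter L x) := by
  refine measurable_from_prod_countable_right fun k => ?_
  unfold cylCharacter
  fun_prop

/-- The inverse Fourier transform from functions on the dual group `ℤ × ℝ` to functions on
`ℝ × 𝕋_L`. -/
noncomputable def cylFourierInv (L : ℝ) (c : ℤ × ℝ → ℂ) (x : ℝ × AddCircle L) : ℂ :=
  ∫ y, cylCharacter L x y * c y ∂freqMeasure

variable {a b c : ℤ × ℝ → ℂ}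

theorem integrable_cylCharacter_mul (hc : Integrable c freqMeasure) (x : ℝ × AddCircle L) :
    Integrable (fun y => cylCharacter L x y * c y) freqMeasure :=
  hc.bdd_mul (c := 1) (measurable_cylCharacter x).aestronglyMeasurable
    (.of_forall fun y => (norm_cylCharacter x y).le)

theorem continuous_cylFourierInv (hc : Integrable c freqMeasure) :
    Continuous (cylFourierInv L c) := by
  refine continuous_of_dominated
    (fun x => (integrable_cylCharacter_mul hc x).aestronglyMeasurable)
    (fun x => .of_forall fun y => ?_) hc.norm (.of_forall fun y => ?_)
  · rw [norm_mul, norm_cylCharacter, one_mul]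
  · unfold cylCharacter
    fun_prop

theorem cylFourierInv_mul_cylFourierInv (ha : Integrable a freqMeasure)
    (hb : Integrable b freqMeasure) (x : ℝ × AddCircle L) :
    cylFourierInv L b x * cylFourierInv L a x =
      cylFourierInv L (b ⋆[ContinuousLinearMap.mul ℂ ℂ, freqMeasure] a) x := by
  have h := integral_convolution (ContinuousLinearMap.mul ℂ ℂ)
    (integrable_cylCharacter_mul hb x) (integrable_cylCharacter_mul ha x)
  rw [ContinuousLinearMap.mul_apply'] at h
  refine h.symm.trans (integral_congr_ae (.of_forall fun z => ?_))
  simp only [convolution, ContinuousLinearMap.mul_apply']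
  rw [← integral_const_mul]
  congr 1 with y
  rw [← add_sub_cancel y z, cylCharacter_add, add_sub_cancel]
  ring

theorem integrable_slice (hc : Integrable c freqMeasure) (k : ℤ) :
    Integrable fun η => c (k, η) :=
  Measure.ae_count_iff.1 hc.prod_right_ae k

theorem summable_norm_fourierInv_slice (hc : Integrable c freqMeasure) (s : ℝ) :
    Summable fun k : ℤ => ‖𝓕⁻ (fun η => c (k, η)) s‖ := by
  refine (integrable_count_iff.1 hc.integral_norm_prod_left).of_norm_bounded fun k => ?_
  rw [norm_norm, Real.fourierInv_eq]
  refine (norm_integral_le_integral_norm _).trans ?_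
  simp only [Circle.norm_smul]
  exact Real.le_norm_self _

theorem cylFourierInv_eq_tsum (hc : Integrable c freqMeasure) (x : ℝ × AddCircle L) :
    cylFourierInv L c x = ∑' k : ℤ, fourier k x.2 * 𝓕⁻ (fun η => c (k, η)) x.1 := by
  have hint := integrable_cylCharacter_mul hc x
  rw [cylFourierInv, integral_prod _ hint, integral_countable hint.integral_prod_left]
  refine tsum_congr fun k => ?_
  rw [count_real_singleton, one_smul, Real.fourierInv_eq, ← integral_const_mul]
  congr 1 with η
  simp only [cylCharacter, Circle.smul_def, smul_eq_mul, mul_assoc]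
  simp [mul_comm]

theorem lintegral_freqMeasure (hc : AEStronglyMeasurable c freqMeasure) :
    ∫⁻ y, ‖c y‖ₑ ^ 2 ∂freqMeasure = ∑' k : ℤ, ∫⁻ η, ‖c (k, η)‖ₑ ^ 2 := by
  rw [lintegral_prod _ (hc.enorm.pow_const 2), lintegral_count]

theorem lintegral_sq_cylFourierInv_le [Fact (0 < L)] (hc : Integrable c freqMeasure) :
    ∫⁻ x, ‖cylFourierInv L c x‖ₑ ^ 2 ≤ ENNReal.ofReal L * ∫⁻ y, ‖c y‖ₑ ^ 2 ∂freqMeasure := by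
  calc ∫⁻ x, ‖cylFourierInv L c x‖ₑ ^ 2
      = ∫⁻ s, ∫⁻ x₂ : AddCircle L, ‖cylFourierInv L c (s, x₂)‖ₑ ^ 2 :=
        lintegral_prod _ ((continuous_cylFourierInv hc).measurable.enorm.pow_const 2).aemeasurable
    _ = ∫⁻ s, ENNReal.ofReal L * ∑' k : ℤ, ‖𝓕⁻ (fun η => c (k, η)) s‖ₑ ^ 2 := by
        refine lintegral_congr fun s => ?_
        simp only [cylFourierInv_eq_tsum hc]
        exact lintegral_sq_tsum_fourier (summable_norm_fourierInv_slice hc s)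
    _ = ENNReal.ofReal L * ∑' k : ℤ, ∫⁻ s, ‖𝓕⁻ (fun η => c (k, η)) s‖ₑ ^ 2 := by
        rw [lintegral_const_mul' _ _ ENNReal.ofReal_ne_top, lintegral_tsum fun k =>
          ((continuous_fourierInv
            (integrable_slice hc k)).measurable.enorm.pow_const 2).aemeasurable]
    _ ≤ ENNReal.ofReal L * ∑' k : ℤ, ∫⁻ η, ‖c (k, η)‖ₑ ^ 2 := by
        gcongr ENNReal.ofReal L * ?_
        exact ENNReal.tsum_le_tsum fun k => lintegral_sq_fourierInv_le (integrable_slice hc k)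
    _ = _ := by rw [lintegral_freqMeasure hc.1]

end CylinderFourier

section FrequencySide

variable {L : ℝ}

theorem freqMeasure_freqSize_le_lt_top (hL : 0 < L) (ρ : ℝ) :
    freqMeasure {y | freqSize L y ≤ ρ} < ∞ := by
  have hsub : {y | freqSize L y ≤ ρ} ⊆
      (Finset.Icc (-⌊ρ * L⌋) ⌊ρ * L⌋ : Set ℤ) ×ˢ Set.Icc (-ρ) ρ := fun y hy =>
    ⟨Finset.mem_coe.2 (mem_Icc_floor_of_abs_div_le hL ((abs_div_le_freqSize L y).trans hy)),
      abs_le.1 ((abs_snd_le_freqSize L y).trans hy)⟩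
  refine (measure_mono hsub).trans_lt ?_
  rw [Measure.prod_prod]
  exact ENNReal.mul_lt_top (Measure.count_apply_lt_top.2 (Finset.finite_toSet _))
    measure_Icc_lt_top

theorem integrable_of_freqSize_le (hL : 0 < L) {c : ℤ × ℝ → ℂ} (hc : MemLp c 2 freqMeasure) {ρ : ℝ}
    (hρ : ∀ y, c y ≠ 0 → freqSize L y ≤ ρ) : Integrable c freqMeasure := by
  have : IsFiniteMeasure (freqMeasure.restrict {y | freqSize L y ≤ ρ}) :=
    ⟨by simpa using freqMeasure_freqSize_le_lt_top hL ρ⟩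
  rw [← integrableOn_iff_integrable_of_support_subset (s := {y | freqSize L y ≤ ρ}) hρ]
  exact (hc.restrict _).integrable one_le_two

/-- The values of the symbol `m` at the frequencies of `ℝ × 𝕋_L`. -/
noncomputable def FourierSymbol.sample (m : FourierSymbol) (L : ℝ) (y : ℤ × ℝ) : ℂ :=
  m.toFun y.2 (y.1 / L)

theorem FourierSymbol.measurable_sample (m : FourierSymbol) (L : ℝ) :
    Measurable (m.sample L) :=
  m.measurable.comp (f := fun y : ℤ × ℝ => (y.2, (y.1 / L : ℝ))) (by fun_prop)

theorem hyperbolicSymbol_sample (t : ℝ) (y : ℤ × ℝ) :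
    (hyperbolicSymbol t).sample L y = Real.fourierChar (hyperbolicPhase L y * t) := by
  rw [Real.fourierChar_apply, FourierSymbol.sample, hyperbolicSymbol, hyperbolicPhase]
  ring_nf

variable [Fact (0 < L)]

/-- The Fourier transform of `L²(ℝ × 𝕋_L)`, as a function on the dual group `ℤ × ℝ`. -/
noncomputable def cylFourier (L : ℝ) [Fact (0 < L)] (φ : L2Cyl L) (y : ℤ × ℝ) : ℂ :=
  𝓕 (circleCoeff L y.1 φ) y.2

theorem measurable_cylFourier (φ : L2Cyl L) : Measurable (cylFourier L φ) :=
  measurable_from_prod_countable_right fun k =>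
    (Lp.stronglyMeasurable (𝓕 (circleCoeff L k φ))).measurable

theorem Lp_enorm_sq {α : Type*} [MeasurableSpace α] {μ : Measure α} (f : Lp ℂ 2 μ) :
    ‖f‖ₑ ^ 2 = ∫⁻ x, ‖f x‖ₑ ^ 2 ∂μ := by
  rw [Lp.enorm_def, eLpNorm_two_sq]

theorem enorm_fourier_Lp (f : Lp ℂ 2 (volume : Measure ℝ)) : ‖𝓕 f‖ₑ = ‖f‖ₑ := by
  rw [← ofReal_norm, Lp.norm_fourier_eq, ofReal_norm]

theorem circleCoeff_ae_eq_fourierCoeff (φ : L2Cyl L) :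
    ∀ᵐ s : ℝ, ∀ k, circleCoeff L k φ s = fourierCoeff (fun x : AddCircle L => φ (s, x)) k :=
  ae_all_iff.2 fun k => (memLp_circleCoeff L k φ).coeFn_toLp.mono fun s h => by
    rw [fourierCoeff_eq_const_mul_integral]
    exact h

theorem ae_memLp_slice (φ : L2Cyl L) :
    ∀ᵐ s : ℝ, MemLp (fun x : AddCircle L => φ (s, x)) 2 volume := by
  have hφ : AEStronglyMeasurable φ ((volume : Measure ℝ).prod volume) := Lp.aestronglyMeasurable φ
  have hfin : ∫⁻ s : ℝ, ∫⁻ x : AddCircle L, ‖φ (s, x)‖ₑ ^ 2 < ∞ := by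
    rw [← lintegral_prod _ (hφ.enorm.pow_const 2), ← Measure.volume_eq_prod, ← eLpNorm_two_sq]
    exact ENNReal.pow_lt_top (Lp.memLp φ).2
  filter_upwards [hφ.prodMk_left, ae_lt_top' (hφ.enorm.pow_const 2).lintegral_prod_right' hfin.ne]
    with s hmeas hlt
  rw [← eLpNorm_two_sq] at hlt
  exact ⟨hmeas, (ENNReal.pow_lt_top_iff.1 hlt).resolve_right two_ne_zero⟩

theorem lintegral_sq_cylFourier (φ : L2Cyl L) :
    ENNReal.ofReal L * ∫⁻ y, ‖cylFourier L φ y‖ₑ ^ 2 ∂freqMeasure = ‖φ‖ₑ ^ 2 := by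
  have hφ : AEStronglyMeasurable φ ((volume : Measure ℝ).prod volume) := Lp.aestronglyMeasurable φ
  have hslice : ∀ k : ℤ, ∫⁻ η, ‖cylFourier L φ (k, η)‖ₑ ^ 2 = ∫⁻ s, ‖circleCoeff L k φ s‖ₑ ^ 2 :=
    fun k => by
      rw [← Lp_enorm_sq, ← enorm_fourier_Lp, Lp_enorm_sq]
      rfl
  rw [lintegral_freqMeasure (measurable_cylFourier φ).aestronglyMeasurable, tsum_congr hslice,
    ← lintegral_tsum fun k => (Lp.aestronglyMeasurable _).enorm.pow_const 2,
    ← lintegral_const_mul' _ _ ENNReal.ofReal_ne_top, Lp_enorm_sq]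
  refine Eq.trans (lintegral_congr_ae ?_) (lintegral_prod _ (hφ.enorm.pow_const 2)).symm
  filter_upwards [ae_memLp_slice φ, circleCoeff_ae_eq_fourierCoeff φ] with s hs hcoeff
  rw [lintegral_sq_eq_tsum_fourierCoeff hs]
  simp only [hcoeff]

theorem lintegral_sq_cylFourier_lt_top (φ : L2Cyl L) :
    ∫⁻ y, ‖cylFourier L φ y‖ₑ ^ 2 ∂freqMeasure < ∞ := by
  have hL : ENNReal.ofReal L ≠ 0 := (ENNReal.ofReal_pos.2 Fact.out).ne'
  have h : ‖φ‖ₑ ^ 2 < ∞ := ENNReal.pow_lt_top enorm_lt_top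
  rw [← lintegral_sq_cylFourier] at h
  exact ENNReal.lt_top_of_mul_ne_top_right h.ne hL

end FrequencySide

section Multiplier

variable {L : ℝ} [Fact (0 < L)]

theorem symbolMul_ae_eq (m : FourierSymbol) (ξ₂ : ℝ) (g : Lp ℂ 2 (volume : Measure ℝ)) :
    symbolMul m ξ₂ g =ᵐ[volume] fun ξ₁ => m.toFun ξ₁ ξ₂ * g ξ₁ :=
  (memLp_symbolMul m ξ₂ g).coeFn_toLp

theorem symbolMul_eq_zero {m : FourierSymbol} {ξ₂ : ℝ} {g : Lp ℂ 2 (volume : Measure ℝ)}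
    (h : ∀ᵐ ξ₁, m.toFun ξ₁ ξ₂ * g ξ₁ = 0) : symbolMul m ξ₂ g = 0 := by
  refine Lp.ext ?_
  filter_upwards [symbolMul_ae_eq m ξ₂ g, h, Lp.coeFn_zero ℂ 2 (volume : Measure ℝ)]
    with ξ₁ hmul h hzero
  rw [hmul, h, hzero, Pi.zero_apply]

theorem coeFn_sum_mode (S : Finset ℤ) (f : ℤ → Lp ℂ 2 (volume : Measure ℝ)) :
    (∑ k ∈ S, mode L k (f k) : L2Cyl L) =ᵐ[volume]
      fun x => ∑ k ∈ S, fourier k x.2 * f k x.1 := by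
  have hmode : ∀ᵐ x : ℝ × AddCircle L, ∀ k : ℤ, mode L k (f k) x = fourier k x.2 * f k x.1 :=
    ae_all_iff.2 fun k => (memLp_mode L k (f k)).coeFn_toLp
  filter_upwards [Lp.coeFn_finsetSum S fun k => mode L k (f k), hmode] with x hsum hmode
  rw [hsum, Finset.sum_apply]
  exact Finset.sum_congr rfl fun k _ => hmode k

theorem mode_zero (k : ℤ) : mode L k 0 = 0 := by
  have hzero : ∀ᵐ x : ℝ × AddCircle L, (0 : Lp ℂ 2 (volume : Measure ℝ)) x.1 = 0 :=
    Measure.quasiMeasurePreserving_fst.ae (Lp.coeFn_zero ℂ 2 (volume : Measure ℝ))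
  refine Lp.ext ?_
  filter_upwards [(memLp_mode L k 0).coeFn_toLp, hzero, Lp.coeFn_zero ℂ 2 volume]
    with x hmode hfst hx
  rw [hx, Pi.zero_apply]
  exact hmode.trans (by rw [hfst, mul_zero])

theorem circleCoeff_sum_mode (S : Finset ℤ) (f : ℤ → Lp ℂ 2 (volume : Measure ℝ)) (j : ℤ) :
    circleCoeff L j (∑ k ∈ S, mode L k (f k)) = if j ∈ S then f j else 0 := by
  refine Lp.ext ?_
  have hslice := Measure.ae_ae_of_ae_prod (μ := (volume : Measure ℝ))
    (ν := (volume : Measure (AddCircle L))) (coeFn_sum_mode (L := L) S f)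
  filter_upwards [circleCoeff_ae_eq_fourierCoeff (∑ k ∈ S, mode L k (f k)), hslice,
    Lp.coeFn_zero ℂ 2 (volume : Measure ℝ)] with s hcoeff hs hzero
  set c : ℤ → ℂ := fun k => if k ∈ S then f k s else 0
  have hc : ∀ k ∉ S, c k = 0 := fun k hk => if_neg hk
  have hseries : (fun x : AddCircle L => ∑ k ∈ S, fourier k x * f k s) =
      fun x => ∑' k, fourier k x * c k := funext fun x => by
    rw [tsum_eq_sum fun k hk => by rw [hc k hk, mul_zero]]
    exact Finset.sum_congr rfl fun k hk => by simp only [c, if_pos hk]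
  rw [hcoeff j, fourierCoeff_eq_const_mul_integral,
    integral_congr_ae (hs.mono fun x hx => congrArg (fourier (-j) x * ·) hx),
    ← fourierCoeff_eq_const_mul_integral, hseries, fourierCoeff_tsum_fourier
      (summable_of_ne_finset_zero (s := S) fun k hk => by rw [hc k hk, norm_zero])]
  simp only [c]
  split_ifs
  · rfl
  · exact hzero.symm

theorem fourierMultiplier_eq_sum {m : FourierSymbol} {S : Finset ℤ} {φ : L2Cyl L}
    (h : ∀ k ∉ S, ∀ᵐ ξ₁, m.toFun ξ₁ (k / L) * 𝓕 (circleCoeff L k φ) ξ₁ = 0) :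
    fourierMultiplier L m φ =
      ∑ k ∈ S, mode L k (𝓕⁻ (symbolMul m (k / L) (𝓕 (circleCoeff L k φ)))) :=
  tsum_eq_sum fun k hk => by
    rw [symbolMul_eq_zero (h k hk), FourierTransform.fourierInv_zero, mode_zero]

theorem fourierMultiplier_sum_mode (m : FourierSymbol) (S : Finset ℤ)
    (f : ℤ → Lp ℂ 2 (volume : Measure ℝ)) :
    fourierMultiplier L m (∑ k ∈ S, mode L k (f k)) =
      ∑ k ∈ S, mode L k (𝓕⁻ (symbolMul m (k / L) (𝓕 (f k)))) := by
  rw [fourierMultiplier_eq_sum (S := S) fun k hk => ?_]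
  · exact Finset.sum_congr rfl fun k hk => by rw [circleCoeff_sum_mode, if_pos hk]
  · rw [circleCoeff_sum_mode, if_neg hk, FourierTransform.fourier_zero]
    filter_upwards [Lp.coeFn_zero ℂ 2 (volume : Measure ℝ)] with ξ₁ hzero
    rw [hzero, Pi.zero_apply, mul_zero]

theorem sum_mode_fourierInv_ae_eq {c : ℤ × ℝ → ℂ} (hc : Integrable c freqMeasure) {S : Finset ℤ}
    (hS : ∀ k ∉ S, ∀ η, c (k, η) = 0) {f : ℤ → Lp ℂ 2 (volume : Measure ℝ)}
    (hf : ∀ k, f k =ᵐ[volume] fun η => c (k, η)) :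
    (∑ k ∈ S, mode L k (𝓕⁻ (f k)) : L2Cyl L) =ᵐ[volume] cylFourierInv L c := by
  have hinv : ∀ᵐ x : ℝ × AddCircle L, ∀ k : ℤ,
      (𝓕⁻ (f k) : Lp ℂ 2 (volume : Measure ℝ)) x.1 = 𝓕⁻ (fun η => c (k, η)) x.1 :=
    ae_all_iff.2 fun k => Measure.quasiMeasurePreserving_fst.ae
      (fourierInv_Lp_ae_eq (integrable_slice hc k) (hf k))
  filter_upwards [coeFn_sum_mode S fun k => 𝓕⁻ (f k), hinv] with x hsum hinv
  rw [hsum, cylFourierInv_eq_tsum hc, tsum_eq_sum fun k hk => ?_]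
  · exact Finset.sum_congr rfl fun k _ => by rw [hinv k]
  · simp [hS k hk, Real.fourierInv_eq]

variable {m : FourierSymbol} {ρ : ℝ}

/-- The Fourier transform of `fourierMultiplier L m φ`, as a function on the dual group `ℤ × ℝ`. -/
noncomputable def multiplierCoeff (L : ℝ) [Fact (0 < L)] (m : FourierSymbol) (φ : L2Cyl L)
    (y : ℤ × ℝ) : ℂ :=
  m.sample L y * cylFourier L φ y

theorem measurable_multiplierCoeff (m : FourierSymbol) (φ : L2Cyl L) :
    Measurable (multiplierCoeff L m φ) :=
  (m.measurable_sample L).mul (measurable_cylFourier φ)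

theorem memLp_multiplierCoeff (m : FourierSymbol) (φ : L2Cyl L) :
    MemLp (multiplierCoeff L m φ) 2 freqMeasure := by
  obtain ⟨B, hB⟩ := m.bounded
  have hφ : MemLp (cylFourier L φ) 2 freqMeasure := by
    refine ⟨(measurable_cylFourier φ).aestronglyMeasurable, ?_⟩
    refine (ENNReal.pow_lt_top_iff.1 ?_).resolve_right two_ne_zero
    rw [eLpNorm_two_sq]
    exact lintegral_sq_cylFourier_lt_top φ
  refine hφ.of_le_mul (c := B) (measurable_multiplierCoeff m φ).aestronglyMeasurable
    (.of_forall fun y => ?_)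
  rw [multiplierCoeff, norm_mul]
  exact mul_le_mul_of_nonneg_right (hB _ _) (norm_nonneg _)

theorem integrable_multiplierCoeff (hm : ∀ y, m.sample L y ≠ 0 → freqSize L y ≤ ρ)
    (φ : L2Cyl L) : Integrable (multiplierCoeff L m φ) freqMeasure :=
  integrable_of_freqSize_le Fact.out (memLp_multiplierCoeff m φ)
    fun y hy => hm y (left_ne_zero_of_mul hy)

theorem hyperbolicFlow_fourierMultiplier_ae_eq
    (hm : ∀ y, m.sample L y ≠ 0 → freqSize L y ≤ ρ) (t : ℝ) (φ : L2Cyl L) :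
    hyperbolicFlow L t (fourierMultiplier L m φ) =ᵐ[volume]
      cylFourierInv L (evolve (hyperbolicPhase L) t (multiplierCoeff L m φ)) := by
  have hzero : ∀ k ∉ Finset.Icc (-⌊ρ * L⌋) ⌊ρ * L⌋, ∀ η, m.toFun η (k / L) = 0 :=
    fun k hk η => by_contra fun h => hk (mem_Icc_floor_of_abs_div_le Fact.out
      ((abs_div_le_freqSize L (k, η)).trans (hm (k, η) h)))
  rw [hyperbolicFlow, fourierMultiplier_eq_sum (m := m) (φ := φ)
    fun k hk => .of_forall fun η => by rw [hzero k hk, zero_mul], fourierMultiplier_sum_mode]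
  refine sum_mode_fourierInv_ae_eq (integrable_evolve (measurable_hyperbolicPhase L) t
    (integrable_multiplierCoeff hm φ)) (fun k hk η => ?_) fun k => ?_
  · simp only [evolve, multiplierCoeff, FourierSymbol.sample, hzero k hk, zero_mul, mul_zero]
  · rw [FourierTransform.fourier_fourierInv_eq]
    filter_upwards [symbolMul_ae_eq (hyperbolicSymbol t) (k / L) _,
      symbolMul_ae_eq m (k / L) (𝓕 (circleCoeff L k φ))] with η hflow hmul
    rw [hflow, hmul, evolve, multiplierCoeff, ← hyperbolicSymbol_sample]
    rfl

end Multiplier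

section BilinearCylinder

variable {L B ρ ρ₁ σ : ℝ} [Fact (0 < L)] {m m₁ m₂ : FourierSymbol}

theorem lintegral_sq_multiplierCoeff_le (hB : ∀ y, ‖m.sample L y‖ ≤ B) (φ : L2Cyl L) :
    ENNReal.ofReal L * ∫⁻ y, ‖multiplierCoeff L m φ y‖ₑ ^ 2 ∂freqMeasure ≤
      ENNReal.ofReal B ^ 2 * ‖φ‖ₑ ^ 2 := by
  rw [← lintegral_sq_cylFourier φ, mul_left_comm,
    ← lintegral_const_mul' (ENNReal.ofReal B ^ 2) _ (by finiteness)]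
  refine mul_le_mul_right (lintegral_mono fun y => ?_) _
  rw [multiplierCoeff, enorm_mul, mul_pow]
  gcongr
  rw [← ofReal_norm]
  exact ENNReal.ofReal_le_ofReal (hB y)

theorem eLpNorm_sq_hyperbolicFlow_mul_le
    (hm₁ : ∀ y, m₁.sample L y ≠ 0 → freqSize L y ≤ ρ₁)
    (hm₂ : ∀ y, m₂.sample L y ≠ 0 → freqSize L y ≤ ρ) (φ₁ φ₂ : L2Cyl L) (t : ℝ) :
    eLpNorm (fun x => hyperbolicFlow L t (fourierMultiplier L m₁ φ₁) x *
        hyperbolicFlow L t (fourierMultiplier L m₂ φ₂) x) 2 volume ^ 2 ≤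
      ENNReal.ofReal L * ∫⁻ y,
        ‖(evolve (hyperbolicPhase L) t (multiplierCoeff L m₂ φ₂)
          ⋆[ContinuousLinearMap.mul ℂ ℂ, freqMeasure]
          evolve (hyperbolicPhase L) t (multiplierCoeff L m₁ φ₁)) y‖ₑ ^ 2 ∂freqMeasure := by
  have ha := integrable_evolve (measurable_hyperbolicPhase L) t (integrable_multiplierCoeff hm₁ φ₁)
  have hb := integrable_evolve (measurable_hyperbolicPhase L) t (integrable_multiplierCoeff hm₂ φ₂)
  refine le_trans (le_of_eq ?_)
    (lintegral_sq_cylFourierInv_le (hb.integrable_convolution (ContinuousLinearMap.mul ℂ ℂ) ha))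
  rw [eLpNorm_two_sq]
  refine lintegral_congr_ae ?_
  filter_upwards [hyperbolicFlow_fourierMultiplier_ae_eq hm₁ t φ₁,
    hyperbolicFlow_fourierMultiplier_ae_eq hm₂ t φ₂] with x h₁ h₂
  rw [h₁, h₂, mul_comm, cylFourierInv_mul_cylFourierInv ha hb]

theorem lintegral_sq_evolve_multiplierCoeff_convolution_le (hρ : 1 ≤ ρ) (hσ : 2 * ρ ≤ σ)
    (hm₁ : ∀ y, m₁.sample L y ≠ 0 → σ ≤ freqSize L y ∧ freqSize L y ≤ ρ₁)
    (hm₂ : ∀ y, m₂.sample L y ≠ 0 → freqSize L y ≤ ρ) (φ₁ φ₂ : L2Cyl L) :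
    ∫⁻ t in Set.Icc (0 : ℝ) 1, ∫⁻ y,
        ‖(evolve (hyperbolicPhase L) t (multiplierCoeff L m₂ φ₂)
          ⋆[ContinuousLinearMap.mul ℂ ℂ, freqMeasure]
          evolve (hyperbolicPhase L) t (multiplierCoeff L m₁ φ₁)) y‖ₑ ^ 2 ∂freqMeasure ≤
      12 * ENNReal.ofReal (320 * (1 + ρ * L / σ)) *
        ((∫⁻ y, ‖multiplierCoeff L m₂ φ₂ y‖ₑ ^ 2 ∂freqMeasure) *
          ∫⁻ y, ‖multiplierCoeff L m₁ φ₁ y‖ₑ ^ 2 ∂freqMeasure) := by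
  refine lintegral_sq_evolve_convolution_le (measurable_hyperbolicPhase L)
    (measurable_multiplierCoeff m₁ φ₁) (measurable_multiplierCoeff m₂ φ₂)
    (integrable_multiplierCoeff (fun y hy => (hm₁ y hy).2) φ₁)
    (integrable_multiplierCoeff hm₂ φ₂) fun x τ =>
      (measure_mono ?_).trans (freqMeasure_resonant_le Fact.out hρ hσ x τ)
  rintro y ⟨hy, hτ⟩
  exact ⟨hm₂ y (left_ne_zero_of_mul (left_ne_zero_of_mul hy)),
    (hm₁ _ (left_ne_zero_of_mul (right_ne_zero_of_mul hy))).1, hτ⟩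

theorem lintegral_sq_hyperbolicFlow_mul_le (hρ : 1 ≤ ρ) (hσ : 2 * ρ ≤ σ)
    (hB₁ : ∀ y, ‖m₁.sample L y‖ ≤ B) (hB₂ : ∀ y, ‖m₂.sample L y‖ ≤ B)
    (hm₁ : ∀ y, m₁.sample L y ≠ 0 → σ ≤ freqSize L y ∧ freqSize L y ≤ ρ₁)
    (hm₂ : ∀ y, m₂.sample L y ≠ 0 → freqSize L y ≤ ρ) (φ₁ φ₂ : L2Cyl L) :
    ∫⁻ t in Set.Icc (0 : ℝ) 1, eLpNorm (fun x =>
        hyperbolicFlow L t (fourierMultiplier L m₁ φ₁) x *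
          hyperbolicFlow L t (fourierMultiplier L m₂ φ₂) x) 2 volume ^ 2 ≤
      ENNReal.ofReal (3840 * (1 / L + ρ / σ)) *
        ((ENNReal.ofReal B ^ 2 * ‖φ₂‖ₑ ^ 2) * (ENNReal.ofReal B ^ 2 * ‖φ₁‖ₑ ^ 2)) := by
  have hL : 0 < L := Fact.out
  have hpos : 0 < σ := by linarith
  have hconst : ENNReal.ofReal L * (12 * ENNReal.ofReal (320 * (1 + ρ * L / σ))) =
      ENNReal.ofReal (3840 * (1 / L + ρ / σ)) * ENNReal.ofReal L * ENNReal.ofReal L := by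
    rw [← ENNReal.ofReal_ofNat 12, ← ENNReal.ofReal_mul (by positivity),
      ← ENNReal.ofReal_mul (by positivity), ← ENNReal.ofReal_mul (by positivity),
      ← ENNReal.ofReal_mul (by positivity)]
    congr 1
    field_simp
    ring
  calc _ ≤ ∫⁻ t in Set.Icc (0 : ℝ) 1, ENNReal.ofReal L * ∫⁻ y, _ ∂freqMeasure :=
      lintegral_mono fun t =>
        eLpNorm_sq_hyperbolicFlow_mul_le (fun y hy => (hm₁ y hy).2) hm₂ φ₁ φ₂ t
    _ ≤ ENNReal.ofReal L * (12 * ENNReal.ofReal (320 * (1 + ρ * L / σ)) *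
        ((∫⁻ y, ‖multiplierCoeff L m₂ φ₂ y‖ₑ ^ 2 ∂freqMeasure) *
          ∫⁻ y, ‖multiplierCoeff L m₁ φ₁ y‖ₑ ^ 2 ∂freqMeasure)) := by
      rw [lintegral_const_mul' _ _ ENNReal.ofReal_ne_top]
      exact mul_le_mul_right
        (lintegral_sq_evolve_multiplierCoeff_convolution_le hρ hσ hm₁ hm₂ φ₁ φ₂) _
    _ = ENNReal.ofReal (3840 * (1 / L + ρ / σ)) *
        ((ENNReal.ofReal L * ∫⁻ y, ‖multiplierCoeff L m₂ φ₂ y‖ₑ ^ 2 ∂freqMeasure) *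
          (ENNReal.ofReal L * ∫⁻ y, ‖multiplierCoeff L m₁ φ₁ y‖ₑ ^ 2 ∂freqMeasure)) := by
      rw [← mul_assoc, hconst]
      ring
    _ ≤ _ := mul_le_mul_right (mul_le_mul' (lintegral_sq_multiplierCoeff_le hB₂ φ₂)
      (lintegral_sq_multiplierCoeff_le hB₁ φ₁)) _

theorem spaceTimeL2Norm_hyperbolicFlow_mul_le (hρ : 1 ≤ ρ) (hσ : 2 * ρ ≤ σ)
    (hB₁ : ∀ y, ‖m₁.sample L y‖ ≤ B) (hB₂ : ∀ y, ‖m₂.sample L y‖ ≤ B)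
    (hm₁ : ∀ y, m₁.sample L y ≠ 0 → σ ≤ freqSize L y ∧ freqSize L y ≤ ρ₁)
    (hm₂ : ∀ y, m₂.sample L y ≠ 0 → freqSize L y ≤ ρ) (φ₁ φ₂ : L2Cyl L) :
    spaceTimeL2Norm L (fun t x => hyperbolicFlow L t (fourierMultiplier L m₁ φ₁) x *
        hyperbolicFlow L t (fourierMultiplier L m₂ φ₂) x) ≤
      ENNReal.ofReal (62 * B ^ 2 * (1 / L + ρ / σ) ^ (1 / 2 : ℝ) * ‖φ₁‖ * ‖φ₂‖) := by
  have hL : 0 < L := Fact.out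
  have hpos : 0 < σ := by linarith
  have hB : 0 ≤ B := (norm_nonneg _).trans (hB₁ 0)
  set s := 1 / L + ρ / σ
  have hs : 0 ≤ s := by positivity
  have hsqrt : (s ^ (2⁻¹ : ℝ)) ^ 2 = s := by
    rw [← one_div, ← Real.sqrt_eq_rpow, Real.sq_sqrt hs]
  rw [spaceTimeL2Norm, one_div, ENNReal.rpow_inv_le_iff two_pos, ENNReal.rpow_two]
  calc _ ≤ ENNReal.ofReal (3840 * s) *
        ((ENNReal.ofReal B ^ 2 * ‖φ₂‖ₑ ^ 2) * (ENNReal.ofReal B ^ 2 * ‖φ₁‖ₑ ^ 2)) :=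
      lintegral_sq_hyperbolicFlow_mul_le hρ hσ hB₁ hB₂ hm₁ hm₂ φ₁ φ₂
    _ = ENNReal.ofReal (3840 * s * ((B ^ 2 * ‖φ₂‖ ^ 2) * (B ^ 2 * ‖φ₁‖ ^ 2))) := by
      simp only [← ofReal_norm, ← ENNReal.ofReal_pow hB, ← ENNReal.ofReal_pow (norm_nonneg _)]
      rw [← ENNReal.ofReal_mul (by positivity), ← ENNReal.ofReal_mul (by positivity),
        ← ENNReal.ofReal_mul (by positivity), ← ENNReal.ofReal_mul (by positivity)]
    _ ≤ ENNReal.ofReal (62 ^ 2 * s * ((B ^ 2 * ‖φ₂‖ ^ 2) * (B ^ 2 * ‖φ₁‖ ^ 2))) := by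
      gcongr
      norm_num
    _ = _ := by
      rw [← ENNReal.ofReal_pow (by positivity)]
      congr 1
      simp only [mul_pow, hsqrt]
      ring

end BilinearCylinder

namespace LittlewoodPaleyCutoff

variable (ψ : LittlewoodPaleyCutoff) {L : ℝ} {N : ℕ}

/-- The symbol of the projection `P_N`. -/
noncomputable def symbol (N : ℕ) : FourierSymbol :=
  if N = 1 then ψ.low else ψ.shell.dilate N

theorem exists_norm_symbol_le : ∃ B, ∀ L N y, ‖(ψ.symbol N).sample L y‖ ≤ B := by
  obtain ⟨B₁, h₁⟩ := ψ.low.bounded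
  obtain ⟨B₂, h₂⟩ := ψ.shell.bounded
  refine ⟨max B₁ B₂, fun L N y => ?_⟩
  unfold symbol
  split_ifs
  · exact (h₁ _ _).trans (le_max_left _ _)
  · exact (h₂ _ _).trans (le_max_right _ _)

theorem shell_dilate_support (hN : 1 ≤ N) {y : ℤ × ℝ} (h : (ψ.shell.dilate N).sample L y ≠ 0) :
    ψ.r * N ≤ freqSize L y ∧ freqSize L y ≤ ψ.R * N := by
  have hN' : (0 : ℝ) < N := by exact_mod_cast hN
  have hdilate : √((y.2 / N) ^ 2 + (y.1 / L / N) ^ 2) = freqSize L y / N := by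
    rw [div_pow _ (N : ℝ), div_pow _ (N : ℝ), ← add_div, Real.sqrt_div' _ (sq_nonneg _),
      Real.sqrt_sq hN'.le, freqSize]
  have hsupport := ψ.shell_support _ _ h
  rwa [hdilate, le_div_iff₀ hN', div_le_iff₀ hN'] at hsupport

theorem freqSize_le_of_symbol_ne_zero (hN : 1 ≤ N) {y : ℤ × ℝ}
    (h : (ψ.symbol N).sample L y ≠ 0) : freqSize L y ≤ max ψ.R 1 * N := by
  refine le_trans ?_ (mul_le_mul_of_nonneg_right (le_max_left _ _) N.cast_nonneg)
  unfold symbol at h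
  split_ifs at h with h_one
  · simpa [h_one, freqSize] using ψ.low_support _ _ h
  · exact (ψ.shell_dilate_support hN h).2

theorem le_freqSize_of_symbol_ne_zero (hN : 2 ≤ N) {y : ℤ × ℝ}
    (h : (ψ.symbol N).sample L y ≠ 0) : ψ.r * N ≤ freqSize L y := by
  rw [symbol, if_neg (by lia)] at h
  exact (ψ.shell_dilate_support (by lia) h).1

end LittlewoodPaleyCutoff

theorem theorem1p3_general (ψ : LittlewoodPaleyCutoff) :
    ∃ K C : ℝ, ∀ (L : ℝ) [Fact (0 < L)],
      ∀ N₁ N₂ : ℕ, 1 ≤ N₂ → K * (N₂ : ℝ) ≤ (N₁ : ℝ) →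
        ∀ φ₁ φ₂ : L2Cyl L,
          spaceTimeL2Norm L (fun t x =>
            hyperbolicFlow L t (lpProj ψ L N₁ φ₁) x * hyperbolicFlow L t (lpProj ψ L N₂ φ₂) x) ≤
          ENNReal.ofReal
            (C * (1 / L + (N₂ : ℝ) / (N₁ : ℝ)) ^ (1 / 2 : ℝ) * ‖φ₁‖ * ‖φ₂‖) := by
  obtain ⟨B, hB⟩ := ψ.exists_norm_symbol_le
  have hr := ψ.r_pos
  set R := max ψ.R 1
  have hR : 1 ≤ R := le_max_right _ _
  refine ⟨max 2 (2 * R / ψ.r), 62 * B ^ 2 * (1 + R / ψ.r) ^ (1 / 2 : ℝ),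
    fun L _ N₁ N₂ hN₂ hK φ₁ φ₂ => ?_⟩
  have hL : 0 < L := Fact.out
  have hN₂' : (1 : ℝ) ≤ N₂ := by exact_mod_cast hN₂
  have hN₁ : 2 ≤ N₁ := by
    have : (2 : ℝ) ≤ N₁ := by nlinarith [le_max_left 2 (2 * R / ψ.r)]
    exact_mod_cast this
  have hseparated : 2 * (R * N₂) ≤ ψ.r * N₁ := by
    have h : 2 * R / ψ.r * N₂ ≤ N₁ := le_trans (by gcongr; exact le_max_right _ _) hK
    rw [div_mul_eq_mul_div, div_le_iff₀ hr] at h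
    linarith
  have hscale : 1 / L + R * N₂ / (ψ.r * N₁) ≤ (1 + R / ψ.r) * (1 / L + N₂ / N₁) := by
    rw [mul_div_mul_comm]
    have h₁ : 0 ≤ R / ψ.r * (1 / L) := by positivity
    have h₂ : 0 ≤ (N₂ : ℝ) / N₁ := by positivity
    linarith
  have hbilinear := spaceTimeL2Norm_hyperbolicFlow_mul_le
    (one_le_mul_of_one_le_of_one_le hR hN₂') hseparated (hB L N₁) (hB L N₂)
    (fun y hy => ⟨ψ.le_freqSize_of_symbol_ne_zero hN₁ hy,
      ψ.freqSize_le_of_symbol_ne_zero (by lia) hy⟩)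
    (fun y hy => ψ.freqSize_le_of_symbol_ne_zero hN₂ hy) φ₁ φ₂
  refine hbilinear.trans (ENNReal.ofReal_le_ofReal ?_)
  rw [mul_assoc (62 * B ^ 2) ((1 + R / ψ.r) ^ (1 / 2 : ℝ)),
    ← Real.mul_rpow (by positivity) (by positivity)]
  gcongr

/-- Bilinear Strichartz estimate for `e^{it□}` on `ℝ × 𝕋_L`, for every choice of the
Littlewood-Paley cutoffs; `N₁ ≫ N₂` means `N₁ ≥ K N₂` for a sufficiently large constant `K`, and
neither `K` nor `C` depends on `L`, `N₁`, `N₂`, `φ₁`, `φ₂`. -/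
theorem theorem1p3 (ψ : LittlewoodPaleyCutoff) :
    ∃ K C : ℝ, ∀ (L : ℝ) [Fact (0 < L)], 1 ≤ L →
      ∀ N₁ N₂ : ℕ, 1 ≤ N₂ → K * (N₂ : ℝ) ≤ (N₁ : ℝ) →
        ∀ φ₁ φ₂ : L2Cyl L,
          spaceTimeL2Norm L (fun t x =>
            hyperbolicFlow L t (lpProj ψ L N₁ φ₁) x * hyperbolicFlow L t (lpProj ψ L N₂ φ₂) x) ≤
          ENNReal.ofReal
            (C * (1 / L + (N₂ : ℝ) / (N₁ : ℝ)) ^ (1 / 2 : ℝ) * ‖φ₁‖ * ‖φ₂‖) := by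
  obtain ⟨K, C, h⟩ := theorem1p3_general ψ
  exact ⟨K, C, fun L _ _ => h L⟩
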